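/- **Proposition 1.6 (Stability).** Let $W_n$ be the group of signed permutations of $\{1,\ldots,n\}$, written in one-line notation $w=(w_1,\ldots,w_n)$ with a bar for a minus sign. It is generated by $s_0,s_1,\ldots,s_{n-1}$, acting on the right: $s_0$ changes the sign of the first entry, and $s_i$ ($i\ge 1$) interchanges the entries in positions $i$ and $i+1$. For $m<n$ let $i_{m,n}\colon W_m\hookrightarrow W_n$ be the embedding via the first $m$ components, and let $W_\infty=\bigcup_n W_n$, with length function $\ell$ with respect to $s_0,s_1,\ldots$. For $u,v\in W_\infty$ write $u\le v$ (weak Bruhat order) if $v=u\,s_{a_1}\cdots s_{a_r}$ for some generators with $r=\ell(v)-\ell(u)\ge 0$. For $k>0$ let $w_{\rho_k}=(\overline{k},\overline{k-1},\ldots,\overline{1},k+1,k+2,\ldots)\in W_\infty$. Let $X_n=(x_1,\ldots,x_n)$ and $Y_n=(y_1,\ldots,y_n)$. Let $s_0$ act on $\mathbb{Z}[X_n,Y_n]$ by $x_1\mapsto -x_1$ and $s_i$ ($1\le i\le n-1$) by interchanging $x_i$ and $x_{i+1}$, all other variables being fixed, and put $$\partial'_0f=\frac{f-s_0f}{2x_1},\qquad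 \partial'_if=-\frac{f-s_if}{x_i-x_{i+1}}\quad(1\le i\le n-1),$$ and $\partial'_w=\partial'_{a_1}\circ\cdots\circ\partial'_{a_r}$ for any reduced decomposition $w=s_{a_1}\cdots s_{a_r}$ of $w\in W_n$ (this does not depend on the decomposition). Put $$\widetilde Q_{i}=e_i,\qquad \widetilde Q_{i,j}=\widetilde Q_i\widetilde Q_j+2\sum_{h=1}^{j}(-1)^h\widetilde Q_{i+h}\widetilde Q_{j-h},$$ where $e_i$ is the $i$-th elementary symmetric polynomial in $n$ variables, and for a strict partition $\lambda=(\lambda_1>\cdots>\lambda_r\ge 0)$ with $r$ even (a zero part being added if necessary) let $\widetilde Q_\lambda$ be the Pfaffian of $[\widetilde Q_{\lambda_i,\lambda_j}]_{1\le i<j\le r}$. Let $$\Delta(X_n,Y_n)=\prod_{i,j\ge1,\ i+j\le n}(x_i-y_j),\qquad \widetilde Q(X_n,Y_n)=\sum_{\lambda}\widetilde Q_\lambda(X_n)\,\widetilde Q_{\lambda'}(Y_n),$$ where $\lambda$ runs over the strict partitions with parts in $\{1,\ldots,n\}$ and $\lambda'$ is the strict partition whose parts are the elements of $\{1,\ldots,n\}$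 that are not parts of $\lambda$. With $w_0=(\overline1,\ldots,\overline n)$, the type $C$ double Schubert polynomial of $w\in W_n$ is $$\mathfrak C_w(X_n,Y_n)=(-1)^{n(n-1)/2}\,\partial'_{w^{-1}w_0}\bigl(\Delta(X_n,Y_n)\,\widetilde Q(X_n,Y_n)\bigr).$$ Let $w\in W_m$, and suppose that $w\le w_{\rho_k}$ in $W_\infty$ for some $k>0$. Then $\mathfrak C_w$ is stable: for all $n>m$, $$\mathfrak C_{i_{m,n}(w)}(X_n,Y_n)\Big|_{x_{m+1}=\cdots=x_n=y_{m+1}=\cdots=y_n=0}=\mathfrak C_w(X_m,Y_m).$$ -/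

import Mathlib

noncomputable section

namespace TypeC

/-! ### Signed permutations -/

/-- The hyperoctahedral group `W_n`: bijections `w` of `ℤ` with `w (-i) = - w i` which fix every
integer of absolute value larger than `n`. The one-line notation of `w` is `(w 1, …, w n)`, a bar
over an entry being a minus sign; the product is composition of maps. -/
def W (n : ℕ) : Subgroup (Equiv.Perm ℤ) where
  carrier := {w | (∀ i, w (-i) = - w i) ∧ ∀ i, (n : ℤ) < |i| → w i = i}
  mul_mem' := by
    rintro a b ⟨ha, ha'⟩ ⟨hb, hb'⟩
    refine ⟨fun i => by simp [hb, ha], fun i hi => ?_⟩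
    simp [hb' i hi, ha' i hi]
  one_mem' := by simp
  inv_mem' := by
    rintro a ⟨ha, ha'⟩
    refine ⟨fun i => ?_, fun i hi => ?_⟩
    · rw [Equiv.Perm.inv_eq_iff_eq, ha]; simp
    · rw [Equiv.Perm.inv_eq_iff_eq, ha' i hi]

theorem W_mono {m n : ℕ} (h : m ≤ n) : W m ≤ W n := by
  rintro a ⟨ha, ha'⟩
  exact ⟨ha, fun i hi => ha' i (lt_of_le_of_lt (by exact_mod_cast h) hi)⟩

/-- The embedding `W_m ↪ W_n` via the first `m` components. -/
def emb {m n : ℕ} (h : m ≤ n) : W m →* W n := Subgroup.inclusion (W_mono h)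

/-- The infinite hyperoctahedral group, the union of all `W_n`. -/
def Winf : Subgroup (Equiv.Perm ℤ) where
  carrier := {w | ∃ n, w ∈ W n}
  mul_mem' := by
    rintro a b ⟨m, ha⟩ ⟨n, hb⟩
    exact ⟨max m n, mul_mem (W_mono (le_max_left m n) ha) (W_mono (le_max_right m n) hb)⟩
  one_mem' := ⟨0, one_mem _⟩
  inv_mem' := by
    rintro a ⟨m, ha⟩
    exact ⟨m, inv_mem ha⟩

theorem W_le_Winf (n : ℕ) : W n ≤ Winf := fun _ h => ⟨n, h⟩

/-- The inclusion `W_n ↪ W_∞`. -/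
def toInf (n : ℕ) : W n →* Winf := Subgroup.inclusion (W_le_Winf n)

/-- The generator `s_i` as a map: `s_0` changes the sign of `1`, and for `i ≥ 1` the
transposition `s_i` interchanges `i` and `i + 1` (and hence `-i` and `-(i + 1)`). -/
def sFun : ℕ → Equiv.Perm ℤ
  | 0 => Equiv.swap 1 (-1)
  | i + 1 => Equiv.swap (i + 1 : ℤ) (i + 2) * Equiv.swap (-(i + 1 : ℤ)) (-(i + 2 : ℤ))

theorem sFun_mem_W (i : ℕ) : sFun i ∈ W (i + 1) := by
  cases i with
  | zero =>
    refine ⟨fun j => ?_, fun j hj => ?_⟩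
    · simp only [sFun, Equiv.swap_apply_def]; split_ifs <;> omega
    · rw [lt_abs] at hj
      simp only [sFun, Equiv.swap_apply_def]
      push_cast at hj
      split_ifs <;> omega
  | succ i =>
    refine ⟨fun j => ?_, fun j hj => ?_⟩
    · simp only [sFun, Equiv.Perm.mul_apply, Equiv.swap_apply_def]; split_ifs <;> omega
    · rw [lt_abs] at hj
      simp only [sFun, Equiv.Perm.mul_apply, Equiv.swap_apply_def]
      push_cast at hj
      split_ifs <;> omega

/-- The generator `s_i` of `W_∞`. -/
def s (i : ℕ) : Winf := ⟨sFun i, i + 1, sFun_mem_W i⟩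

/-- `a` is a word in the generators `s_i`, `i ∈ I`, whose product is `w`. -/
def IsWord (I : Set ℕ) (w : Winf) (a : List ℕ) : Prop :=
  (∀ i ∈ a, i ∈ I) ∧ (a.map s).prod = w

/-- The length function of `W_∞` with respect to all the generators `s_0, s_1, …`. -/
def length (w : Winf) : ℕ := sInf {r | ∃ a : List ℕ, IsWord Set.univ w a ∧ a.length = r}

/-- The weak Bruhat order on `W_∞`: `v = u s_{a_1} ⋯ s_{a_r}` with `ℓ(v) = ℓ(u) + r`. -/
def WeakLE (u v : Winf) : Prop :=
  ∃ a : List ℕ, v = u * (a.map s).prod ∧ length v = length u + a.length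

/-- `a` is a reduced decomposition of `w ∈ W_n` in the generators `s_0, …, s_{n-1}` of `W_n`. -/
def IsReduced (n : ℕ) (w : W n) (a : List ℕ) : Prop :=
  IsWord (Set.Iio n) (toInf n w) a ∧
    ∀ b : List ℕ, IsWord (Set.Iio n) (toInf n w) b → a.length ≤ b.length

/-- The underlying map of the longest element of `W_n`. -/
def w₀Fun (n : ℕ) (i : ℤ) : ℤ := if |i| ≤ n then -i else i

theorem w₀Fun_involutive (n : ℕ) (i : ℤ) : w₀Fun n (w₀Fun n i) = i := by
  by_cases h : |i| ≤ n <;> simp [w₀Fun, h]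

/-- The longest element `w_0 = (-1, -2, …, -n)` of `W_n`. -/
def w₀ (n : ℕ) : W n :=
  ⟨⟨w₀Fun n, w₀Fun n, w₀Fun_involutive n, w₀Fun_involutive n⟩, by
    refine ⟨fun i => ?_, fun i hi => ?_⟩
    · change w₀Fun n (-i) = -w₀Fun n i
      simp only [w₀Fun, abs_neg]
      split_ifs <;> rfl
    · change w₀Fun n i = i
      simp [w₀Fun, not_le.mpr hi]⟩

/-- The underlying map of `w_{ρ_k}`: one has `i ↦ -(k + 1 - i)` for `1 ≤ i ≤ k`, and all `i > k`
are fixed. -/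
def wRhoFun (k : ℕ) (i : ℤ) : ℤ :=
  if 1 ≤ i ∧ i ≤ k then -(k + 1 - i)
  else if 1 ≤ -i ∧ -i ≤ k then k + 1 - (-i)
  else i

theorem wRhoFun_involutive (k : ℕ) (i : ℤ) : wRhoFun k (wRhoFun k i) = i := by
  simp only [wRhoFun]
  split_ifs <;> omega

/-- The maximal Grassmannian element `w_{ρ_k} = (-k, -(k-1), …, -1, k+1, k+2, …)` of `W_∞`. -/
def wRho (k : ℕ) : Winf :=
  ⟨⟨wRhoFun k, wRhoFun k, wRhoFun_involutive k, wRhoFun_involutive k⟩, k, by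
    refine ⟨fun i => ?_, fun i hi => ?_⟩
    · change wRhoFun k (-i) = -wRhoFun k i
      simp only [wRhoFun]
      split_ifs <;> omega
    · change wRhoFun k i = i
      rw [lt_abs] at hi
      simp only [wRhoFun]
      split_ifs <;> omega⟩

/-! ### Existence of reduced decompositions -/

/-- Moving an entry `e` with `1 ≤ |e| ≤ n + 1` to the position `n + 1`. -/
theorem exists_word_pos (n j : ℕ) (d : ℕ) (hj : 1 ≤ j) (hd : j + d = n + 1) :
    ∃ a : List ℕ, (∀ i ∈ a, i < n + 1) ∧ ((a.map sFun).prod) (j : ℤ) = (n + 1 : ℕ) := by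
  induction d generalizing j with
  | zero => exact ⟨[], by simp, by simp; omega⟩
  | succ d ih =>
    obtain ⟨a, ha, hp⟩ := ih (j + 1) (by omega) (by omega)
    refine ⟨a ++ [j], ?_, ?_⟩
    · intro i hi
      rcases List.mem_append.1 hi with h | h
      · exact ha i h
      · simp at h; omega
    · obtain ⟨q, rfl⟩ : ∃ q, j = q + 1 := ⟨j - 1, by omega⟩
      have h1 : sFun (q + 1) ((q + 1 : ℕ) : ℤ) = ((q + 1 + 1 : ℕ) : ℤ) := by
        simp only [sFun, Equiv.Perm.mul_apply, Equiv.swap_apply_def]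
        push_cast
        split_ifs <;> omega
      rw [List.map_append, List.prod_append, Equiv.Perm.mul_apply]
      simp only [List.map_cons, List.map_nil, List.prod_cons, List.prod_nil, mul_one]
      rw [h1, hp]

theorem exists_word_neg (n j : ℕ) (hj : 1 ≤ j) (hn : j ≤ n + 1) :
    ∃ a : List ℕ, (∀ i ∈ a, i < n + 1) ∧ ((a.map sFun).prod) (-(j : ℤ)) = (n + 1 : ℕ) := by
  induction j, hj using Nat.le_induction with
  | base =>
    obtain ⟨a, ha, hp⟩ := exists_word_pos n 1 n le_rfl (by omega)
    refine ⟨a ++ [0], ?_, ?_⟩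
    · intro i hi
      rcases List.mem_append.1 hi with h | h
      · exact ha i h
      · simp at h; omega
    · have h1 : sFun 0 (-((1 : ℕ) : ℤ)) = ((1 : ℕ) : ℤ) := by
        simp [sFun]
      rw [List.map_append, List.prod_append, Equiv.Perm.mul_apply]
      simp only [List.map_cons, List.map_nil, List.prod_cons, List.prod_nil, mul_one]
      rw [h1, hp]
  | succ q hq ih =>
    obtain ⟨a, ha, hp⟩ := ih (by omega)
    refine ⟨a ++ [q], ?_, ?_⟩
    · intro i hi
      rcases List.mem_append.1 hi with h | h
      · exact ha i h
      · simp at h; omega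
    · obtain ⟨q, rfl⟩ : ∃ p, q = p + 1 := ⟨q - 1, by omega⟩
      have h1 : sFun (q + 1) (-((q + 1 + 1 : ℕ) : ℤ)) = -((q + 1 : ℕ) : ℤ) := by
        simp only [sFun, Equiv.Perm.mul_apply, Equiv.swap_apply_def]
        push_cast
        split_ifs <;> omega
      rw [List.map_append, List.prod_append, Equiv.Perm.mul_apply]
      simp only [List.map_cons, List.map_nil, List.prod_cons, List.prod_nil, mul_one]
      rw [h1, hp]

theorem sFun_inv (i : ℕ) : (sFun i)⁻¹ = sFun i := by
  rw [inv_eq_iff_mul_eq_one]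
  cases i with
  | zero => simp [sFun]
  | succ i =>
    ext j
    simp only [sFun, Equiv.Perm.mul_apply, Equiv.swap_apply_def, Equiv.Perm.one_apply]
    split_ifs <;> omega

theorem prod_sFun_inv (a : List ℕ) : ((a.map sFun).prod)⁻¹ = (a.reverse.map sFun).prod := by
  induction a with
  | nil => simp
  | cons i a ih => simp [ih, sFun_inv]

theorem prod_sFun_mem (n : ℕ) (a : List ℕ) (ha : ∀ i ∈ a, i < n) : (a.map sFun).prod ∈ W n := by
  apply Subgroup.list_prod_mem
  intro x hx
  obtain ⟨i, hi, rfl⟩ := List.mem_map.1 hx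
  exact W_mono (ha i hi) (sFun_mem_W i)

theorem exists_word (n : ℕ) (w : Equiv.Perm ℤ) (hw : w ∈ W n) :
    ∃ a : List ℕ, (∀ i ∈ a, i < n) ∧ (a.map sFun).prod = w := by
  induction n generalizing w with
  | zero =>
    refine ⟨[], by simp, ?_⟩
    ext i
    by_cases hi : i = 0
    · have := hw.1 0
      subst hi
      simp only [neg_zero] at this
      simp only [List.map_nil, List.prod_nil, Equiv.Perm.one_apply]
      omega
    · simpa using (hw.2 i (by simpa using hi)).symm
  | succ n ih =>
    have h0 : w 0 = 0 := by have := hw.1 0; simp only [neg_zero] at this; omega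
    have hne : w (n + 1 : ℕ) ≠ 0 := by
      intro h
      have := w.injective (h.trans h0.symm)
      omega
    have hle : |w (n + 1 : ℕ)| ≤ (n + 1 : ℕ) := by
      by_contra h
      push Not at h
      have h' := w.injective (hw.2 _ h)
      rw [h', Nat.abs_cast] at h
      exact lt_irrefl _ h
    have key : ∃ a : List ℕ, (∀ i ∈ a, i < n + 1) ∧
        ((a.map sFun).prod) (w (n + 1 : ℕ)) = (n + 1 : ℕ) := by
      rw [abs_le] at hle
      rcases lt_or_gt_of_ne hne with h | h
      · obtain ⟨j, hj⟩ := Int.eq_ofNat_of_zero_le (a := -(w (n + 1 : ℕ))) (by omega)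
        have : w (n + 1 : ℕ) = -(j : ℤ) := by omega
        rw [this]
        exact exists_word_neg n j (by omega) (by omega)
      · obtain ⟨j, hj⟩ := Int.eq_ofNat_of_zero_le (a := (w (n + 1 : ℕ))) (by omega)
        rw [hj]
        exact exists_word_pos n j (n + 1 - j) (by omega) (by omega)
    obtain ⟨a, ha, hp⟩ := key
    have hu : (a.map sFun).prod * w ∈ W (n + 1) := mul_mem (prod_sFun_mem _ a ha) hw
    have hu' : (a.map sFun).prod * w ∈ W n := by
      refine ⟨hu.1, fun i hi => ?_⟩
      by_cases h : ((n + 1 : ℕ) : ℤ) < |i|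
      · exact hu.2 i h
      · have : |i| = (n + 1 : ℕ) := by push_cast at h ⊢; omega
        have hfix : ((a.map sFun).prod * w) (n + 1 : ℕ) = (n + 1 : ℕ) := by
          rw [Equiv.Perm.mul_apply, hp]
        rcases abs_eq (by omega) |>.1 this with rfl | rfl
        · exact hfix
        · rw [hu.1, hfix]
    obtain ⟨b, hb, hbp⟩ := ih _ hu'
    refine ⟨a.reverse ++ b, ?_, ?_⟩
    · intro i hi
      rcases List.mem_append.1 hi with h | h
      · exact ha i (List.mem_reverse.1 h)
      · exact (hb i h).trans (Nat.lt_succ_self n)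
    · rw [List.map_append, List.prod_append, hbp, ← prod_sFun_inv, inv_mul_cancel_left]

theorem exists_isWord (n : ℕ) (w : W n) : ∃ a : List ℕ, IsWord (Set.Iio n) (toInf n w) a := by
  obtain ⟨a, ha, hp⟩ := exists_word n w.1 w.2
  refine ⟨a, ha, Subtype.ext ?_⟩
  rw [Subgroup.val_list_prod, List.map_map]
  exact hp

theorem exists_isReduced (n : ℕ) (w : W n) : ∃ a : List ℕ, IsReduced n w a := by
  classical
  have hne : {a : List ℕ | IsWord (Set.Iio n) (toInf n w) a}.Nonempty := exists_isWord n w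
  refine ⟨Function.argminOn List.length _ hne, Function.argminOn_mem List.length _ hne,
    fun b hb => ?_⟩
  exact Function.argminOn_le List.length _ hb

/-! ### Divided differences -/

/-- The polynomial ring `ℤ[x_1, x_2, …, y_1, y_2, …]`; the polynomials of `ℤ[X_n, Y_n]` are those
in `x_1, …, x_n, y_1, …, y_n`. (The variables with index `0` are never used.) -/
abbrev Poly : Type := MvPolynomial (ℕ ⊕ ℕ) ℤ

/-- The variable `x_i`, for `i ≥ 1`. -/
def x (i : ℕ) : Poly := MvPolynomial.X (Sum.inl i)

/-- The variable `y_i`, for `i ≥ 1`. -/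
def y (i : ℕ) : Poly := MvPolynomial.X (Sum.inr i)

/-- The action of `s_i` on polynomials: `s_0` replaces `x_1` by `-x_1`, and `s_i` for `i ≥ 1`
interchanges `x_i` and `x_{i+1}`; all other variables are fixed. -/
def act : ℕ → Poly →ₐ[ℤ] Poly
  | 0 => MvPolynomial.aeval (Sum.elim (fun j => if j = 1 then -x 1 else x j) y)
  | i + 1 => MvPolynomial.aeval (Sum.elim (fun j => x (Equiv.swap (i + 1) (i + 2) j)) y)

/-- The denominators `2 x_1` and `x_i - x_{i+1}` of the divided differences. -/
def root : ℕ → Poly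
  | 0 => 2 * x 1
  | i + 1 => x (i + 1) - x (i + 2)

theorem root_dvd (i : ℕ) (f : Poly) : root i ∣ f - act i f := by
  induction f using MvPolynomial.induction_on with
  | C a => simp [← MvPolynomial.algebraMap_eq]
  | add p q hp hq =>
    have : p + q - act i (p + q) = (p - act i p) + (q - act i q) := by rw [map_add]; ring
    rw [this]; exact dvd_add hp hq
  | mul_X p v hp =>
    have hX : root i ∣ MvPolynomial.X v - act i (MvPolynomial.X v) := by
      rcases i with _ | i <;> rcases v with v | v
      · by_cases h : v = 1
        · subst h; exact ⟨1, by simp [act, root, x]; ring⟩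
        · simp [act, h, x]
      · simp [act, y]
      · by_cases h : v = i + 1
        · subst h; exact ⟨1, by simp [act, root, x]⟩
        · by_cases h' : v = i + 2
          · subst h'; exact ⟨-1, by simp [act, root, x]⟩
          · simp [act, x, Equiv.swap_apply_of_ne_of_ne h h']
      · simp [act, y]
    have : p * MvPolynomial.X v - act i (p * MvPolynomial.X v) =
        (p - act i p) * MvPolynomial.X v +
          act i p * (MvPolynomial.X v - act i (MvPolynomial.X v)) := by rw [map_mul]; ring
    rw [this]
    exact dvd_add (Dvd.dvd.mul_right hp _) (Dvd.dvd.mul_left hX _)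

/-- The divided difference operators `∂_0 f = (f - s_0 f) / (2 x_1)` and
`∂_i f = (f - s_i f) / (x_i - x_{i+1})` for `i ≥ 1`. -/
def dd (i : ℕ) (f : Poly) : Poly := Classical.choose (root_dvd i f)

theorem root_mul_dd (i : ℕ) (f : Poly) : root i * dd i f = f - act i f :=
  (Classical.choose_spec (root_dvd i f)).symm

/-- The operators `∂'_0 = ∂_0` and `∂'_i = -∂_i` for `i ≥ 1`. -/
def dd' : ℕ → Poly → Poly
  | 0, f => dd 0 f
  | i + 1, f => - dd (i + 1) f

/-- `∂'_{a_1} ∘ ⋯ ∘ ∂'_{a_r}` for a word `a`. -/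
def ddWord' (a : List ℕ) (f : Poly) : Poly := a.foldr dd' f

/-- The operator `∂'_w` for `w ∈ W_n`, through a reduced decomposition of `w`. (By the Coxeter
relations between the `∂'_i` it does not depend on which one is taken.) -/
def ddW' (n : ℕ) (w : W n) (f : Poly) : Poly :=
  ddWord' (Classical.choose (exists_isReduced n w)) f

/-! ### The `Q̃`-polynomials and the double Schubert polynomials -/

/-- The elementary symmetric polynomial `e_i(z_1, …, z_n)`, which is `Q̃_i`. -/
def e (z : ℕ → Poly) (n i : ℕ) : Poly :=
  ∑ t ∈ (Finset.Icc 1 n).powersetCard i, ∏ j ∈ t, z j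

/-- `Q̃_{i,j}(z_1, …, z_n)`. -/
def qTilde₂ (z : ℕ → Poly) (n i j : ℕ) : Poly :=
  e z n i * e z n j +
    2 * ∑ k ∈ Finset.Icc 1 j, (-1) ^ k * e z n (i + k) * e z n (j - k)

/-- The Pfaffian of the skew-symmetric matrix of size `2r` with entries `a i j` for `i < j`, by
expansion along the first row; only the entries above the diagonal are used. -/
def pfaffian {R : Type*} [CommRing R] : (r : ℕ) → (Fin (2 * r) → Fin (2 * r) → R) → R
  | 0, _ => 1
  | r + 1, a => ∑ j : Fin (2 * r + 1), (-1) ^ (j : ℕ) * a 0 j.succ *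
      pfaffian r (fun p q => a (j.succAbove p).succ (j.succAbove q).succ)

/-- The parts `λ_1 > λ_2 > ⋯` of a strict partition, which is given by the finite set of its
nonzero parts, listed in decreasing order from index `0` on and followed by zeros. -/
def part (lam : Finset ℕ) (i : ℕ) : ℕ := (lam.sort (· ≥ ·)).getD i 0

/-- `Q̃_λ(z_1, …, z_n)` for a strict partition `λ`: the Pfaffian of `Q̃_{λ_i, λ_j}`, of size
`ℓ(λ)` or `ℓ(λ) + 1`, whichever is even. -/
def qTilde (z : ℕ → Poly) (n : ℕ) (lam : Finset ℕ) : Poly :=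
  pfaffian ((lam.card + 1) / 2) (fun i j => qTilde₂ z n (part lam i) (part lam j))

/-- The kernel `Q̃(X_n, Y_n) = ∑ Q̃_λ(X_n) Q̃_{λ'}(Y_n)`, summed over the strict partitions `λ` with
parts in `{1, …, n}`, where `λ'` has the complementary set of parts. -/
def qKernel (n : ℕ) : Poly :=
  ∑ lam ∈ (Finset.Icc 1 n).powerset, qTilde x n lam * qTilde y n (Finset.Icc 1 n \ lam)

/-- `Δ(X_n, Y_n)`, the product of `x_i - y_j` over `i, j ≥ 1` with `i + j ≤ n`. -/
def vdm (n : ℕ) : Poly :=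
  ∏ p ∈ (Finset.Icc 1 n ×ˢ Finset.Icc 1 n) with p.1 + p.2 ≤ n, (x p.1 - y p.2)

/-- The type `C` double Schubert polynomial `ℭ_w(X_n, Y_n)` of `w ∈ W_n`. -/
def schubertC (n : ℕ) (w : W n) : Poly :=
  (-1) ^ (n * (n - 1) / 2) * ddW' n (w⁻¹ * w₀ n) (vdm n * qKernel n)

/-- The substitution `x_{m+1} = ⋯ = x_n = y_{m+1} = ⋯ = y_n = 0`. -/
def setZero (m n : ℕ) : Poly →ₐ[ℤ] Poly :=
  MvPolynomial.aeval (Sum.elim (fun j => if m < j ∧ j ≤ n then 0 else x j)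
    (fun j => if m < j ∧ j ≤ n then 0 else y j))

/-- `ℭ_w(X_m, Y_m)`, for `w ∈ W_m`, is stable. -/
def IsStable (m : ℕ) (w : W m) : Prop :=
  ∀ (n : ℕ) (h : m < n), setZero m n (schubertC n (emb h.le w)) = schubertC m w

end TypeC

end

noncomputable section

namespace TypeC

/-! ### Divided differences -/

/-! The order hypothesis serves only to show that w⁻¹ increases on the positive integers
(`incPos_of_weakLE`). Write w₀ = w_{ρ_n}σ with σ the longest element of the symmetric group. Then
the lengths add in w⁻¹w₀ = (w⁻¹w_{ρ_n})σ. The kernel Q̃(X_n,Y_n) is symmetric in X_n, so ∂'_σ merely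
strips off Δ up to the sign, and ℭ_w = ∂'_{w⁻¹w_{ρ_n}} Q̃(X_n,Y_n) (`schubertC_eq`).

It is enough to compare ranks m+1 and m. Since w_{ρ_{m+1}} = w_{ρ_m} s_m⋯s_1s_0, a reduced word d of
w⁻¹w_{ρ_m} followed by m,…,1,0 is reduced in rank m+1. The operators along d involve only x_1,…,x_m
and commute with the substitution, so the claim reduces to w = w_{ρ_m}: ∂'_m⋯∂'_1∂'_0
Q̃(X_{m+1},Y_{m+1}) specializes to Q̃(X_m,Y_m) (`setZero_ddWord'_qKernel`). At y_{m+1}=0 only the λ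
containing m+1 survive, and the Pfaffian factorization `qTilde_of_mem` splits x_1⋯x_{m+1} off the
kernel (`killY_qKernel`). At x_{m+1}=0 the operators remove exactly this product
(`killX_ddWord'_prodX`).

Because ∂'_w is defined through a chosen reduced word, the argument also needs that length is half
the count `inv` (`isReduced_iff`) and that reduced words of one element give the same operator
(`RedWord.ddWord'_eq`), which follows from the braid relations. -/

theorem root_ne_zero (i : ℕ) : root i ≠ 0 := by
  rcases i with _ | i
  · exact mul_ne_zero two_ne_zero (MvPolynomial.X_ne_zero _)
  · simp only [root, x]
    rw [sub_ne_zero]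
    intro h
    have := MvPolynomial.X_injective h
    simp at this

/-- Polynomials form a domain, so the chosen quotient is determined by its defining equation. -/
theorem dd_unique {i : ℕ} {f p : Poly} (h : root i * p = f - act i f) : dd i f = p :=
  mul_left_cancel₀ (root_ne_zero i) ((root_mul_dd i f).trans h.symm)

theorem dd_mul_of_invariant {i : ℕ} {g : Poly} (hg : act i g = g) (f : Poly) :
    dd i (g * f) = g * dd i f := by
  apply dd_unique
  rw [map_mul, hg, ← mul_sub, ← root_mul_dd]
  ring

theorem dd'_mul_of_invariant {i : ℕ} {g : Poly} (hg : act i g = g) (f : Poly) :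
    dd' i (g * f) = g * dd' i f := by
  rcases i with _ | i
  · exact dd_mul_of_invariant hg f
  · simp only [dd', dd_mul_of_invariant hg f, mul_neg]

theorem ddWord'_mul_of_invariant {a : List ℕ} {g : Poly} (hg : ∀ i ∈ a, act i g = g) (f : Poly) :
    ddWord' a (g * f) = g * ddWord' a f := by
  induction a with
  | nil => rfl
  | cons i a ih =>
    change dd' i (ddWord' a (g * f)) = g * dd' i (ddWord' a f)
    rw [ih fun j hj => hg j (List.mem_cons_of_mem _ hj),
      dd'_mul_of_invariant (hg i List.mem_cons_self)]

/-- Used both for substitutions of zero and for the action of a distant generator. -/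
theorem map_dd {φ : Poly →ₐ[ℤ] Poly} {i : ℕ} (hr : φ (root i) = root i)
    (hc : ∀ f, φ (act i f) = act i (φ f)) (f : Poly) : φ (dd i f) = dd i (φ f) := by
  symm
  apply dd_unique
  rw [← hc, ← map_sub, ← root_mul_dd, map_mul, hr]

theorem map_dd' {φ : Poly →ₐ[ℤ] Poly} {i : ℕ} (hr : φ (root i) = root i)
    (hc : ∀ f, φ (act i f) = act i (φ f)) (f : Poly) : φ (dd' i f) = dd' i (φ f) := by
  rcases i with _ | i
  · exact map_dd hr hc f
  · simp only [dd', map_neg, map_dd hr hc]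

theorem map_ddWord' {φ : Poly →ₐ[ℤ] Poly} {a : List ℕ} (hr : ∀ i ∈ a, φ (root i) = root i)
    (hc : ∀ i ∈ a, ∀ f, φ (act i f) = act i (φ f)) (f : Poly) :
    φ (ddWord' a f) = ddWord' a (φ f) := by
  induction a with
  | nil => rfl
  | cons i a ih =>
    change φ (dd' i (ddWord' a f)) = dd' i (ddWord' a (φ f))
    rw [map_dd' (hr i List.mem_cons_self) (hc i List.mem_cons_self),
      ih (fun j hj => hr j (List.mem_cons_of_mem _ hj))
        (fun j hj => hc j (List.mem_cons_of_mem _ hj))]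

theorem ddWord'_cons (i : ℕ) (a : List ℕ) (f : Poly) :
    ddWord' (i :: a) f = dd' i (ddWord' a f) := rfl

theorem ddWord'_append (a b : List ℕ) (f : Poly) :
    ddWord' (a ++ b) f = ddWord' a (ddWord' b f) := by
  simp [ddWord', List.foldr_append]

/-- Two algebra endomorphisms agree if they agree on the variables. -/
theorem algHom_congr {φ ψ : Poly →ₐ[ℤ] Poly} (hx : ∀ j, φ (x j) = ψ (x j))
    (hy : ∀ j, φ (y j) = ψ (y j)) (f : Poly) : φ f = ψ f := by
  congr 1
  apply MvPolynomial.algHom_ext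
  rintro (j | j)
  · exact hx j
  · exact hy j

/-! ### The generators acting on variables and roots. -/

@[simp] theorem act_y (i j : ℕ) : act i (y j) = y j := by
  rcases i with _ | i <;> simp [act, y]

theorem act_zero_x (j : ℕ) : act 0 (x j) = if j = 1 then -x 1 else x j := by
  simp [act, x]

theorem act_succ_x (i j : ℕ) : act (i + 1) (x j) = x (Equiv.swap (i + 1) (i + 2) j) := by
  simp [act, x]

@[simp] theorem act_zero_x_one : act 0 (x 1) = -x 1 := by simp [act_zero_x]

@[simp] theorem act_zero_x_of_ne {j : ℕ} (h : j ≠ 1) : act 0 (x j) = x j := by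
  simp [act_zero_x, h]

@[simp] theorem act_x_left (i : ℕ) : act (i + 1) (x (i + 1)) = x (i + 2) := by
  simp [act_succ_x]

@[simp] theorem act_x_right (i : ℕ) : act (i + 1) (x (i + 2)) = x (i + 1) := by
  simp [act_succ_x]

theorem act_x_of_ne {i j : ℕ} (h : j ≠ i) (h' : j ≠ i + 1) : act i (x j) = x j := by
  rcases i with _ | i
  · exact act_zero_x_of_ne h'
  · rw [act_succ_x, Equiv.swap_apply_of_ne_of_ne h h']

theorem x_ne_zero (j : ℕ) : x j ≠ 0 := MvPolynomial.X_ne_zero _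

theorem act_act (i : ℕ) (f : Poly) : act i (act i f) = f := by
  have := algHom_congr (φ := (act i).comp (act i)) (ψ := AlgHom.id ℤ Poly) (fun j => ?_)
    (fun j => by simp) f
  · simpa using this
  rcases i with _ | i
  · by_cases h : j = 1 <;> simp [h]
  · simp [act_succ_x]

theorem act_root (i : ℕ) : act i (root i) = -root i := by
  rcases i with _ | i
  · rw [root, map_mul, act_zero_x_one, map_ofNat]
    ring
  · simp [root]

/-- The reflection negates both the numerator and the denominator of the quotient. -/
theorem act_dd (i : ℕ) (f : Poly) : act i (dd i f) = dd i f := by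
  apply mul_left_cancel₀ (root_ne_zero i)
  have := congrArg (act i) (root_mul_dd i f)
  rw [map_mul, act_root, map_sub, act_act] at this
  linear_combination -this - root_mul_dd i f

/-! ### Braid relations -/

theorem act_comm {i j : ℕ} (h : i + 2 ≤ j) (f : Poly) :
    act i (act j f) = act j (act i f) := by
  refine algHom_congr (φ := (act i).comp (act j)) (ψ := (act j).comp (act i)) (fun t => ?_)
    (fun t => by simp) f
  obtain ⟨j, rfl⟩ : ∃ q, j = q + 1 := ⟨j - 1, by omega⟩
  simp only [AlgHom.comp_apply]
  by_cases h1 : t = j + 1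
  · subst h1
    rw [act_x_left, act_x_of_ne (by omega) (by omega), act_x_of_ne (by omega) (by omega),
      act_x_left]
  by_cases h2 : t = j + 2
  · subst h2
    rw [act_x_right, act_x_of_ne (by omega) (by omega), act_x_of_ne (by omega) (by omega),
      act_x_right]
  rw [act_x_of_ne (i := j + 1) h1 h2]
  rcases i with _ | i
  · by_cases h3 : t = 1
    · subst h3
      simp [act_x_of_ne h1 h2]
    · simp [h3, act_x_of_ne h1 h2]
  · rw [act_succ_x, act_x_of_ne]
    all_goals
      rw [Equiv.swap_apply_def]
      split_ifs <;> omega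

theorem act_root_of_far {i j : ℕ} (h : i + 2 ≤ j) :
    act i (root j) = root j ∧ act j (root i) = root i := by
  obtain ⟨j, rfl⟩ : ∃ q, j = q + 1 := ⟨j - 1, by omega⟩
  constructor
  · rw [root, map_sub, act_x_of_ne (by omega) (by omega), act_x_of_ne (by omega) (by omega)]
  · rcases i with _ | i
    · rw [root, map_mul, act_x_of_ne (by omega) (by omega), map_ofNat]
    · rw [root, map_sub, act_x_of_ne (by omega) (by omega), act_x_of_ne (by omega) (by omega)]

theorem dd_comm {i j : ℕ} (h : i + 2 ≤ j) (f : Poly) : dd i (dd j f) = dd j (dd i f) := by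
  obtain ⟨h1, h2⟩ := act_root_of_far h
  apply dd_unique
  -- `map_dd` is applied with φ = `act i`, which fixes `root j` and commutes with `act j`.
  rw [map_dd h1 (act_comm h)]
  apply mul_left_cancel₀ (root_ne_zero j)
  have e1 := root_mul_dd j (dd i f)
  have e2 := root_mul_dd j f
  have e3 := root_mul_dd j (act i f)
  have e4 := root_mul_dd i f
  have e5 := congrArg (act j) e4
  rw [map_mul, h2, map_sub] at e5
  linear_combination (root i) * e1 + e4 - e5 - e2 + e3

theorem act_braid (i : ℕ) (f : Poly) :
    act (i + 1) (act (i + 2) (act (i + 1) f)) = act (i + 2) (act (i + 1) (act (i + 2) f)) := by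
  refine algHom_congr (φ := (act (i + 1)).comp ((act (i + 2)).comp (act (i + 1))))
    (ψ := (act (i + 2)).comp ((act (i + 1)).comp (act (i + 2)))) (fun t => ?_) (fun t => by simp) f
  simp only [AlgHom.comp_apply, act_succ_x]
  congr 1
  simp only [Equiv.swap_apply_def]
  split_ifs <;> omega

theorem act_braid_zero (f : Poly) :
    act 0 (act 1 (act 0 (act 1 f))) = act 1 (act 0 (act 1 (act 0 f))) := by
  refine algHom_congr (φ := ((act 0).comp (act 1)).comp ((act 0).comp (act 1)))
    (ψ := ((act 1).comp (act 0)).comp ((act 1).comp (act 0))) (fun t => ?_) (fun t => by simp) f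
  by_cases h1 : t = 1
  · subst h1; simp
  by_cases h2 : t = 2
  · subst h2; simp
  simp [act_x_of_ne (i := 1) h1 h2, h1]

/-- Three alternating divided differences, for simple roots `α`, `β` spanning a system of
type `A₂`. -/
theorem dd_alternating_three {i j : ℕ} (hj : act j (root i) = root i + root j)
    (hi : act i (root j) = root i + root j) (f : Poly) :
    root i * root j * (root i + root j) * dd i (dd j (dd i f)) =
      f - act i f - act j f + act j (act i f) + act i (act j f) - act i (act j (act i f)) := by
  have e1 := root_mul_dd i f
  have e2 := root_mul_dd j (dd i f)
  have e3 := root_mul_dd i (dd j (dd i f))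
  -- Reflecting the defining equations expresses every reflected divided difference that occurs, so
  -- all intermediate ones can be eliminated linearly.
  have e4 := congrArg (act j) e1
  have e5 := congrArg (act i) e2
  have e6 := congrArg (act i) e4
  simp only [map_mul, map_sub, map_add, hi, hj, act_root, act_dd] at e4 e5 e6
  linear_combination root j * (root i + root j) * e3 + (root i + root j) * e2 - root j * e5
    + e1 - e4 + e6

theorem dd_braid (i : ℕ) (f : Poly) :
    dd (i + 1) (dd (i + 2) (dd (i + 1) f)) = dd (i + 2) (dd (i + 1) (dd (i + 2) f)) := by
  have h1 : act (i + 2) (root (i + 1)) = root (i + 1) + root (i + 2) := by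
    simp only [root, map_sub]
    rw [act_x_of_ne (by omega) (by omega), act_x_left (i + 1)]
    ring
  have h2 : act (i + 1) (root (i + 2)) = root (i + 1) + root (i + 2) := by
    simp only [root, map_sub]
    rw [act_x_of_ne (j := i + 1 + 2) (by omega) (by omega), act_x_right i]
    ring
  have hne : root (i + 1) + root (i + 2) ≠ 0 := by
    intro h
    rw [h] at h1
    apply root_ne_zero (i + 1)
    simpa [act_act] using congrArg (act (i + 2)) h1
  apply mul_left_cancel₀
    (mul_ne_zero (mul_ne_zero (root_ne_zero (i + 1)) (root_ne_zero (i + 2))) hne)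
  rw [dd_alternating_three h1 h2]
  -- Exchanging the two roots changes only the last term of the alternating sum, where `act_braid`
  -- applies.
  have := dd_alternating_three (h2.trans (add_comm _ _)) (h1.trans (add_comm _ _)) f
  linear_combination -this - act_braid i f

/-- Four alternating divided differences, for simple roots `α = root 0`, `β = root 1` spanning a
system of type `C₂`. -/
theorem dd_alternating_four (f : Poly) :
    root 0 * root 1 * (root 0 - root 1) * (root 0 - 2 * root 1) *
        dd 0 (dd 1 (dd 0 (dd 1 f))) =
      -f + act 1 f + act 0 f - act 0 (act 1 f) - act 1 (act 0 f) + act 1 (act 0 (act 1 f))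
        + act 0 (act 1 (act 0 f)) - act 0 (act 1 (act 0 (act 1 f))) ∧
    root 0 * root 1 * (root 0 - root 1) * (root 0 - 2 * root 1) *
        dd 1 (dd 0 (dd 1 (dd 0 f))) =
      -f + act 1 f + act 0 f - act 0 (act 1 f) - act 1 (act 0 f) + act 1 (act 0 (act 1 f))
        + act 0 (act 1 (act 0 f)) - act 1 (act 0 (act 1 (act 0 f))) := by
  -- Here root 0 - root 1 = x_1 + x_2 and root 0 - 2 root 1 = 2x_2, so the common denominator is the
  -- product of the four positive roots.
  have h0 : act 0 (root 1) = root 1 - root 0 := by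
    simp only [root, map_sub, zero_add]
    rw [act_zero_x_one, act_zero_x_of_ne (by omega)]
    ring
  have h1 : act 1 (root 0) = root 0 - 2 * root 1 := by
    simp only [root, map_mul, map_ofNat, zero_add]
    rw [act_x_left 0]
    ring
  constructor
  · have e1 := root_mul_dd 1 f
    have e2 := root_mul_dd 0 (dd 1 f)
    have e3 := root_mul_dd 1 (dd 0 (dd 1 f))
    have e4 := root_mul_dd 0 (dd 1 (dd 0 (dd 1 f)))
    have e3' := congrArg (act 0) e3
    have e2' := congrArg (act 1) e2
    have e2'' := congrArg (act 0) e2'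
    have e1' := congrArg (act 0) e1
    have e1'' := congrArg (act 1) e1'
    have e1''' := congrArg (act 0) e1''
    simp only [map_mul, map_sub, map_neg, map_ofNat, h0, h1, act_root, act_dd]
      at e3' e2' e2'' e1' e1'' e1'''
    linear_combination root 1 * (root 0 - root 1) * (root 0 - 2 * root 1) * e4
      + (root 0 - root 1) * (root 0 - 2 * root 1) * e3
      + root 1 * (root 0 - 2 * root 1) * e3' + (root 0 - 2 * root 1) * e2
      - (root 0 - root 1) * e2' - root 1 * e2'' - e1 + e1' - e1'' + e1'''
  · have e1 := root_mul_dd 0 f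
    have e2 := root_mul_dd 1 (dd 0 f)
    have e3 := root_mul_dd 0 (dd 1 (dd 0 f))
    have e4 := root_mul_dd 1 (dd 0 (dd 1 (dd 0 f)))
    have e3' := congrArg (act 1) e3
    have e2' := congrArg (act 0) e2
    have e2'' := congrArg (act 1) e2'
    have e1' := congrArg (act 1) e1
    have e1'' := congrArg (act 0) e1'
    have e1''' := congrArg (act 1) e1''
    simp only [map_mul, map_sub, map_neg, map_ofNat, h0, h1, act_root, act_dd]
      at e3' e2' e2'' e1' e1'' e1'''
    linear_combination root 0 * (root 0 - root 1) * (root 0 - 2 * root 1) * e4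
      + (root 0 - root 1) * (root 0 - 2 * root 1) * e3
      - root 0 * (root 0 - root 1) * e3' - 2 * (root 0 - root 1) * e2
      + (root 0 - 2 * root 1) * e2' - root 0 * e2'' - e1 + e1' - e1'' + e1'''

theorem dd_braid_zero (f : Poly) :
    dd 0 (dd 1 (dd 0 (dd 1 f))) = dd 1 (dd 0 (dd 1 (dd 0 f))) := by
  have h1 : root 0 - root 1 ≠ 0 := by
    intro h
    apply root_ne_zero 1
    -- The reflection takes x_1 + x_2 to -root 1, already known to be nonzero; below, `act 1` takes
    -- 2x_2 to root 0 in the same way.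
    have := congrArg (act 0) h
    simp only [root, map_sub, map_mul, map_ofNat, zero_add, act_zero_x_one, map_zero] at this
    rw [act_zero_x_of_ne (by omega)] at this
    simp only [root, zero_add]
    linear_combination -this
  have h2 : root 0 - 2 * root 1 ≠ 0 := by
    intro h
    apply root_ne_zero 0
    have := congrArg (act 1) h
    simp only [root, map_sub, map_mul, map_ofNat, zero_add, act_x_left 0, act_x_right 0,
      map_zero] at this
    simp only [root]
    linear_combination this
  obtain ⟨e1, e2⟩ := dd_alternating_four f
  apply mul_left_cancel₀ (mul_ne_zero (mul_ne_zero (mul_ne_zero (root_ne_zero 0) (root_ne_zero 1))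
    h1) h2)
  linear_combination e1 - e2 - act_braid_zero f

theorem dd_neg (i : ℕ) (f : Poly) : dd i (-f) = -dd i f := by
  have := dd_mul_of_invariant (i := i) (g := -1) (by simp) f
  simpa using this

theorem dd'_comm {i j : ℕ} (h : i + 2 ≤ j) (f : Poly) : dd' i (dd' j f) = dd' j (dd' i f) := by
  obtain ⟨j, rfl⟩ : ∃ q, j = q + 1 := ⟨j - 1, by omega⟩
  rcases i with _ | i <;> simp only [dd', dd_neg, dd_comm h]

theorem dd'_braid (i : ℕ) (f : Poly) :
    dd' (i + 1) (dd' (i + 2) (dd' (i + 1) f)) = dd' (i + 2) (dd' (i + 1) (dd' (i + 2) f)) := by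
  simp only [dd', dd_neg, dd_braid]

theorem dd'_braid_zero (f : Poly) :
    dd' 0 (dd' 1 (dd' 0 (dd' 1 f))) = dd' 1 (dd' 0 (dd' 1 (dd' 0 f))) := by
  have := dd_braid_zero f
  simp only [dd', dd_neg, zero_add, this]

/-! ### The longest element of the symmetric group -/

/-- The word `k, k - 1, …, 1`. -/
def downWord : ℕ → List ℕ
  | 0 => []
  | k + 1 => (k + 1) :: downWord k

/-- A word for the longest element of the symmetric group on `{1, …, n}`. -/
def longWord : ℕ → List ℕ
  | 0 => []
  | k + 1 => longWord k ++ downWord k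

theorem mem_downWord {k i : ℕ} (h : i ∈ downWord k) : 1 ≤ i ∧ i ≤ k := by
  induction k with
  | zero => simp [downWord] at h
  | succ k ih =>
    rcases List.mem_cons.1 h with rfl | h
    · omega
    · have := ih h
      omega

theorem mem_longWord {k i : ℕ} (h : i ∈ longWord k) : 1 ≤ i ∧ i < k := by
  induction k with
  | zero => simp [longWord] at h
  | succ k ih =>
    rcases List.mem_append.1 h with h | h
    · have := ih h
      omega
    · have := mem_downWord h
      omega

theorem length_downWord (k : ℕ) : (downWord k).length = k := by
  induction k with
  | zero => rfl
  | succ k ih => simp [downWord, ih]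

/-- The product of the factors `x_i - y_t` for `t ≤ l`. -/
def rowProd (i l : ℕ) : Poly := ∏ t ∈ Finset.Icc 1 l, (x i - y t)

theorem rowProd_succ (i l : ℕ) : rowProd i (l + 1) = rowProd i l * (x i - y (l + 1)) :=
  Finset.prod_Icc_succ_top (by omega) _

theorem act_rowProd_of_ne {a i : ℕ} (h : i ≠ a) (h' : i ≠ a + 1) (l : ℕ) :
    act a (rowProd i l) = rowProd i l := by
  simp [rowProd, map_prod, act_x_of_ne h h']

theorem act_rowProd_left (a l : ℕ) :
    act (a + 1) (rowProd (a + 1) l) = rowProd (a + 2) l := by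
  simp [rowProd, map_prod]

theorem act_rowProd_right (a l : ℕ) :
    act (a + 1) (rowProd (a + 2) l) = rowProd (a + 1) l := by
  simp [rowProd, map_prod]

/-- The row form of the staircase suits the action on x: a generator of the symmetric group only
exchanges two adjacent rows. -/
theorem vdm_eq_prod_rowProd (n : ℕ) :
    vdm n = ∏ i ∈ Finset.range n, rowProd (i + 1) (n - 1 - i) := by
  have h : ∀ i ∈ Finset.Icc 1 n,
      (∏ j ∈ Finset.Icc 1 n, if i + j ≤ n then x i - y j else 1) = rowProd i (n - i) := by
    intro i hi
    rw [← Finset.prod_filter, rowProd]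
    refine Finset.prod_congr ?_ fun _ _ => rfl
    ext j
    simp only [Finset.mem_filter, Finset.mem_Icc] at hi ⊢
    omega
  rw [vdm, Finset.prod_filter, Finset.prod_product, Finset.prod_congr rfl h, Finset.range_eq_Ico,
    ← Finset.Ico_add_one_right_eq_Icc,
    ← Finset.prod_Ico_add' (fun i => rowProd i (n - i)) 0 n 1]
  refine Finset.prod_congr rfl fun i _ => ?_
  rw [Nat.sub_sub, Nat.add_comm 1 i]

/-- The intermediate stages between `vdm (k + 1)` and `vdm k`: the first `j` rows are shortened. -/
def vdmStage (k j : ℕ) : Poly :=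
  (∏ i ∈ Finset.range j, rowProd (i + 1) (k - 1 - i)) *
    ∏ i ∈ Finset.Ico j (k + 1), rowProd (i + 1) (k - i)

theorem vdmStage_zero (k : ℕ) : vdmStage k 0 = vdm (k + 1) := by
  rw [vdm_eq_prod_rowProd, vdmStage, Finset.range_eq_Ico]
  simp

theorem vdmStage_self (k : ℕ) : vdmStage k k = vdm k := by
  rw [vdm_eq_prod_rowProd, vdmStage]
  simp [rowProd]

theorem vdmStage_eq {k j : ℕ} (h : j < k) :
    vdmStage k j = (x (j + 1) - y (k - j)) * vdmStage k (j + 1) := by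
  rw [vdmStage, vdmStage, Finset.prod_range_succ, Finset.prod_eq_prod_Ico_succ_bot (by omega)]
  obtain ⟨d, rfl⟩ : ∃ d, k = j + d + 1 := ⟨k - j - 1, by omega⟩
  have e1 : j + d + 1 - j = d + 1 := by omega
  have e2 : j + d + 1 - 1 - j = d := by omega
  rw [e1, e2, rowProd_succ]
  ring

theorem act_vdmStage {k j : ℕ} (h : j < k) :
    act (j + 1) (vdmStage k (j + 1)) = vdmStage k (j + 1) := by
  rw [vdmStage, Finset.prod_range_succ, Finset.prod_eq_prod_Ico_succ_bot (by omega)]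
  -- Once row j+1 is shortened, rows j+1 and j+2 have equal length, so the reflection exchanges
  -- them.
  have e1 : k - (j + 1) = k - 1 - j := by omega
  rw [e1]
  simp only [map_mul, map_prod]
  rw [act_rowProd_left, act_rowProd_right,
    Finset.prod_congr rfl fun i hi => act_rowProd_of_ne (a := j + 1) (i := i + 1)
      (by simp at hi; omega) (by simp at hi; omega) (k - 1 - i),
    Finset.prod_congr rfl fun i hi => act_rowProd_of_ne (a := j + 1) (i := i + 1)
      (by simp at hi; omega) (by simp at hi; omega) (k - i)]
  ring

/-- ∂'_1 acts first. Each ∂'_{j+1} meets a single factor that is not invariant, x_{j+1} - y_{k-j},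
and replaces it by -1. -/
theorem ddWord'_downWord_vdm {k j : ℕ} (h : j ≤ k) {F : Poly}
    (hF : ∀ i, 1 ≤ i → i ≤ k → act i F = F) :
    ddWord' (downWord j) (vdm (k + 1) * F) = (-1) ^ j * (vdmStage k j * F) := by
  induction j with
  | zero => simp [ddWord', downWord, vdmStage_zero]
  | succ j ih =>
    change dd' (j + 1) (ddWord' (downWord j) _) = _
    rw [ih (by omega), dd'_mul_of_invariant (by simp), vdmStage_eq h]
    have hinv : act (j + 1) (vdmStage k (j + 1) * F) = vdmStage k (j + 1) * F := by
      rw [map_mul, act_vdmStage h, hF _ (by omega) h]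
    have : dd (j + 1) ((x (j + 1) - y (k - j)) * vdmStage k (j + 1) * F) =
        vdmStage k (j + 1) * F := by
      apply dd_unique
      rw [mul_assoc, map_mul, hinv, map_sub, act_x_left, act_y, root]
      ring
    rw [dd', this, pow_succ]
    ring

/-- Each descending block shortens the staircase by one step at the cost of a sign; the signs add up
to a triangular number. -/
theorem ddWord'_longWord_vdm (n : ℕ) {F : Poly} (hF : ∀ i, 1 ≤ i → i < n → act i F = F) :
    ddWord' (longWord n) (vdm n * F) = (-1) ^ (n * (n - 1) / 2) * F := by
  induction n with
  | zero => simp [longWord, ddWord', vdm]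
  | succ n ih =>
    have hs : (n + 1) * (n + 1 - 1) / 2 = n + n * (n - 1) / 2 := by
      have h1 := Nat.triangle_succ n
      simp only [Nat.add_sub_cancel] at h1 ⊢
      omega
    rw [longWord, ddWord'_append, ddWord'_downWord_vdm le_rfl fun i h h' => hF i h (by omega),
      ddWord'_mul_of_invariant (by simp), vdmStage_self,
      ih fun i h h' => hF i h (by omega), hs, pow_add]
    ring

/-! ### Setting the last variable to zero -/

/-- The substitution `x_j = 0`. -/
def killX (j : ℕ) : Poly →ₐ[ℤ] Poly :=
  MvPolynomial.aeval (Sum.elim (fun i => if i = j then 0 else x i) y)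

/-- The substitution `y_j = 0`. -/
def killY (j : ℕ) : Poly →ₐ[ℤ] Poly :=
  MvPolynomial.aeval (Sum.elim x (fun i => if i = j then 0 else y i))

@[simp] theorem killX_x (j i : ℕ) : killX j (x i) = if i = j then 0 else x i := by
  simp [killX, x]

@[simp] theorem killX_y (j i : ℕ) : killX j (y i) = y i := by simp [killX, y]

@[simp] theorem killY_x (j i : ℕ) : killY j (x i) = x i := by simp [killY, x]

@[simp] theorem killY_y (j i : ℕ) : killY j (y i) = if i = j then 0 else y i := by
  simp [killY, y]

theorem killX_succ_act (i : ℕ) (f : Poly) :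
    killX (i + 2) (act (i + 1) f) = act (i + 1) (killX (i + 1) f) := by
  have h : ∀ t, ((killX (i + 2)).comp (act (i + 1))) (x t) =
      ((act (i + 1)).comp (killX (i + 1))) (x t) := by
    intro t
    rw [AlgHom.comp_apply, AlgHom.comp_apply, killX_x]
    by_cases h1 : t = i + 1
    · subst h1
      rw [act_x_left, killX_x, if_pos rfl, if_pos rfl, map_zero]
    by_cases h2 : t = i + 2
    · subst h2
      rw [act_x_right, if_neg h1, act_x_right, killX_x, if_neg (by omega)]
    rw [act_x_of_ne h1 h2, if_neg h1, act_x_of_ne h1 h2, killX_x, if_neg h2]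
  exact algHom_congr h (fun t => by simp only [AlgHom.comp_apply, act_y, killX_y]) f

/-- 2∂_0(x_1 f) = f + s_0 f, and s_0 is invisible at x_1 = 0. -/
theorem killX_dd'_zero (f : Poly) : killX 1 (dd' 0 (x 1 * f)) = killX 1 f := by
  have h1 := root_mul_dd 0 (x 1 * f)
  rw [root, map_mul, act_zero_x_one] at h1
  have h2 : 2 * dd 0 (x 1 * f) = f + act 0 f :=
    mul_left_cancel₀ (x_ne_zero 1) (by linear_combination h1)
  have h3 : killX 1 (act 0 f) = killX 1 f := by
    refine algHom_congr (φ := (killX 1).comp (act 0)) (ψ := killX 1) (fun t => ?_)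
      (fun t => by simp) f
    by_cases h : t = 1 <;> simp [h]
  have h4 := congrArg (killX 1) h2
  rw [map_mul, map_add, h3, map_ofNat] at h4
  exact mul_left_cancel₀ two_ne_zero (h4.trans (two_mul _).symm)

/-- At x_{i+2} = 0 only the reflected term x_{i+1} · s_{i+1}f of the numerator survives, over the
denominator x_{i+1}; the sign in ∂' makes it positive. -/
theorem killX_dd'_succ (i : ℕ) (f : Poly) :
    killX (i + 2) (dd' (i + 1) (x (i + 2) * f)) = act (i + 1) (killX (i + 1) f) := by
  rw [← killX_succ_act, dd', map_neg]
  have h := congrArg (killX (i + 2)) (root_mul_dd (i + 1) (x (i + 2) * f))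
  rw [root, map_mul (act (i + 1)), act_x_right] at h
  simp only [map_mul, map_sub, killX_x] at h
  rw [if_neg (by omega), if_pos trivial] at h
  refine mul_left_cancel₀ (x_ne_zero (i + 1)) ?_
  linear_combination -h

/-- The product `x_1 ⋯ x_n`. -/
def prodX (n : ℕ) : Poly := ∏ i ∈ Finset.Icc 1 n, x i

theorem prodX_succ (n : ℕ) : prodX (n + 1) = x (n + 1) * prodX n := by
  rw [prodX, Finset.prod_Icc_succ_top (by omega), mul_comm, prodX]

/-- The top variable passes through all operators but the leftmost, which consumes it and turns the
substitution into the one for the previous variable. Symmetry of F undoes the resulting reflection.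
-/
theorem killX_ddWord'_prodX (m : ℕ) {F : Poly} (hF : ∀ i, 1 ≤ i → i ≤ m → act i F = F) :
    killX (m + 1) (ddWord' (downWord m ++ [0]) (prodX (m + 1) * F)) = killX (m + 1) F := by
  induction m with
  | zero =>
    have : prodX 1 = x 1 := by simp [prodX]
    rw [zero_add, this]
    exact killX_dd'_zero F
  | succ m ih =>
    rw [downWord, List.cons_append, ddWord'_cons, prodX_succ, mul_assoc,
      ddWord'_mul_of_invariant, killX_dd'_succ,
      ih fun i h h' => hF i h (by omega), ← killX_succ_act, hF _ (by omega) le_rfl]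
    intro i hi
    have : i ≤ m := by
      rcases List.mem_append.1 hi with h | h
      · exact (mem_downWord h).2
      · simp at h; omega
    exact act_x_of_ne (by omega) (by omega)

/-! ### Pfaffians indexed by lists -/

section Pfaffian

variable {ι R : Type*} [CommRing R]

/-- The contraction `∑ k, (-1) ^ k * v l_k * F (l with l_k removed)` of a function on lists. -/
def contract (v : ι → R) : (List ι → R) → List ι → R
  | _, [] => 0
  | F, j :: l => v j * F l - contract v (fun t => F (j :: t)) l

theorem contract_congr (v : ι → R) {F G : List ι → R} {l : List ι}
    (h : ∀ t, t.length + 1 = l.length → F t = G t) : contract v F l = contract v G l := by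
  induction l generalizing F G with
  | nil => rfl
  | cons j l ih =>
    rw [contract, contract, h l rfl, ih fun t ht => h _ (by simp [ht])]

theorem contract_sub (v : ι → R) (F G : List ι → R) (l : List ι) :
    contract v (fun t => F t - G t) l = contract v F l - contract v G l := by
  induction l generalizing F G with
  | nil => simp [contract]
  | cons j l ih => rw [contract, ih]; simp only [contract]; ring

theorem contract_const_mul (v : ι → R) (c : R) (F : List ι → R) (l : List ι) :
    contract v (fun t => c * F t) l = c * contract v F l := by
  induction l generalizing F with
  | nil => simp [contract]
  | cons j l ih => rw [contract, ih]; simp only [contract]; ring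

theorem contract_const_mul_left (v : ι → R) (c : R) (F : List ι → R) (l : List ι) :
    contract (fun i => c * v i) F l = c * contract v F l := by
  induction l generalizing F with
  | nil => simp [contract]
  | cons j l ih => rw [contract, ih]; simp only [contract]; ring

theorem contract_zero_left (F : List ι → R) (l : List ι) : contract (fun _ => 0) F l = 0 := by
  induction l generalizing F with
  | nil => rfl
  | cons j l ih => rw [contract, ih]; ring

theorem contract_contract_cons (v w : ι → R) (F : List ι → R) (j : ι) (l : List ι) :
    contract v (contract w F) (j :: l) = v j * contract w F l - w j * contract v F l +
      contract v (contract w fun t => F (j :: t)) l := by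
  rw [contract]
  simp only [contract]
  rw [contract_sub, contract_const_mul]
  ring

/-- Contractions behave like interior products on an exterior algebra. -/
theorem contract_anticomm (v w : ι → R) (F : List ι → R) (l : List ι) :
    contract v (contract w F) l = -contract w (contract v F) l := by
  induction l generalizing F with
  | nil => simp [contract]
  | cons j l ih =>
    rw [contract_contract_cons, contract_contract_cons, ih]
    ring

/-- Anticommutativity alone would only give twice this, and R may have 2-torsion. -/
theorem contract_self (v : ι → R) (F : List ι → R) (l : List ι) :
    contract v (contract v F) l = 0 := by
  induction l generalizing F with
  | nil => simp [contract]
  | cons j l ih =>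
    rw [contract_contract_cons, ih]
    ring

theorem contract_concat (v : ι → R) (F : List ι → R) (l : List ι) (z : ι) :
    contract v F (l ++ [z]) =
      contract v (fun t => F (t ++ [z])) l + (-1) ^ l.length * (v z * F l) := by
  induction l generalizing F with
  | nil => simp [contract]
  | cons j l ih =>
    rw [List.cons_append, contract, ih, contract, List.length_cons, pow_succ]
    simp only [List.cons_append]
    ring

theorem contract_ofFn (v : ι → R) (F : List ι → R) (N : ℕ) (g : Fin (N + 1) → ι) :
    contract v F (List.ofFn g) =
      ∑ j : Fin (N + 1), (-1) ^ (j : ℕ) * v (g j) * F (List.ofFn fun p => g (j.succAbove p)) := by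
  induction N generalizing F with
  | zero => simp [List.ofFn_succ, contract]
  | succ N ih =>
    rw [List.ofFn_succ, contract, ih, sub_eq_add_neg, ← Finset.sum_neg_distrib]
    conv_rhs => rw [Fin.sum_univ_succ]
    congr 1
    · simp
    · refine Finset.sum_congr rfl fun j _ => ?_
      rw [List.ofFn_succ]
      simp only [Fin.succ_succAbove_zero, Fin.succ_succAbove_succ, Fin.val_succ, pow_succ]
      ring

/-- The Pfaffian with entries `A i j`, where `i` comes before `j` in the list; it vanishes for
lists of odd length. -/
def pf (A : ι → ι → R) : List ι → R
  | [] => 1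
  | i :: l => contract (A i) (fun t => if t.length < (i :: l).length then pf A t else 0) l
  termination_by l => l.length
  decreasing_by assumption

theorem pf_nil (A : ι → ι → R) : pf A [] = 1 := by rw [pf]

/-- The length test in `pf` exists for termination only: a contraction evaluates its function at
lists shorter by one. -/
theorem pf_cons (A : ι → ι → R) (i : ι) (l : List ι) : pf A (i :: l) = contract (A i) (pf A) l := by
  rw [pf]
  exact contract_congr _ fun t ht => if_pos (by simp; omega)

theorem pfaffian_eq_pf (A : ι → ι → R) (r : ℕ) (f : Fin (2 * r) → ι) :
    pfaffian r (fun p q => A (f p) (f q)) = pf A (List.ofFn f) := by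
  induction r with
  | zero => simp [pfaffian, pf_nil]
  | succ r ih =>
    have h : List.ofFn f = f 0 :: List.ofFn (fun p : Fin (2 * r + 1) => f p.succ) :=
      List.ofFn_succ (n := 2 * r + 1)
    rw [h, pf_cons, contract_ofFn, pfaffian]
    refine Finset.sum_congr rfl fun j _ => ?_
    rw [← ih]

/-- Expansion of a Pfaffian along its last column. -/
theorem pf_concat (A : ι → ι → R) (z : ι) (k : ℕ) (l : List ι) (h : l.length = 2 * k + 1) :
    pf A (l ++ [z]) = contract (fun i => A i z) (pf A) l := by
  induction k generalizing l with
  | zero =>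
    obtain ⟨i, rfl⟩ := List.length_eq_one_iff.1 (by simpa using h)
    simp [pf_cons, contract]
  | succ k ih =>
    rcases l with _ | ⟨i, l⟩
    · simp at h
    simp only [List.length_cons] at h
    -- In the expansion along row i, the term pairing i with z splits off; the others form a double
    -- contraction by induction, and anticommuting it moves column z outside.
    rw [List.cons_append, pf_cons, contract_concat, contract_congr _ fun t ht => ih t (by omega),
      contract_anticomm, contract, Even.neg_one_pow ⟨k + 1, by omega⟩]
    rw [show (fun t => pf A (i :: t)) = contract (A i) (pf A) from funext fun t => pf_cons A i t]
    ring

theorem map_contract {S : Type*} [CommRing S] (φ : R →+* S) (v : ι → R) (F : List ι → R)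
    (l : List ι) : φ (contract v F l) = contract (fun i => φ (v i)) (fun t => φ (F t)) l := by
  induction l generalizing F with
  | nil => simp [contract]
  | cons j l ih => rw [contract, contract, map_sub, map_mul, ih]

theorem map_pf {S : Type*} [CommRing S] (φ : R →+* S) (A : ι → ι → R) (l : List ι) :
    φ (pf A l) = pf (fun i j => φ (A i j)) l := by
  induction hl : l.length using Nat.strong_induction_on generalizing l with
  | _ N ih =>
    rcases l with _ | ⟨i, l⟩
    · simp [pf_nil]
    rw [pf_cons, pf_cons, map_contract]
    exact contract_congr _ fun t ht => ih t.length (by simp at hl; omega) t rfl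

end Pfaffian

/-! ### The `Q̃`-polynomials -/

theorem e_zero (z : ℕ → Poly) (n : ℕ) : e z n 0 = 1 := by simp [e]

theorem e_of_lt (z : ℕ → Poly) {n i : ℕ} (h : n < i) : e z n i = 0 := by
  rw [e, Finset.powersetCard_eq_empty.2 (by simpa using h), Finset.sum_empty]

theorem e_self (z : ℕ → Poly) (n : ℕ) : e z n n = ∏ j ∈ Finset.Icc 1 n, z j := by
  have : (Finset.Icc 1 n).powersetCard n = {Finset.Icc 1 n} := by
    simpa using Finset.powersetCard_self (Finset.Icc 1 n)
  rw [e, this, Finset.sum_singleton]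

theorem map_e (φ : Poly →ₐ[ℤ] Poly) (z : ℕ → Poly) (n i : ℕ) :
    φ (e z n i) = e (fun j => φ (z j)) n i := by
  simp [e, map_sum, map_prod]

theorem e_congr {z z' : ℕ → Poly} {n : ℕ} (h : ∀ j, 1 ≤ j → j ≤ n → z j = z' j) (i : ℕ) :
    e z n i = e z' n i := by
  refine Finset.sum_congr rfl fun t ht => Finset.prod_congr rfl fun j hj => ?_
  have := (Finset.mem_powersetCard.1 ht).1 hj
  rw [Finset.mem_Icc] at this
  exact h j this.1 this.2

/-- Elementary symmetric polynomials are symmetric. -/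
theorem e_comp_perm (z : ℕ → Poly) (n i : ℕ) (σ : Equiv.Perm ℕ)
    (h : ∀ j, σ j ∈ Finset.Icc 1 n ↔ j ∈ Finset.Icc 1 n) :
    e (fun j => z (σ j)) n i = e z n i := by
  have hI : (Finset.Icc 1 n).map σ.toEmbedding = Finset.Icc 1 n := by
    ext j
    rw [Finset.mem_map_equiv, ← h, Equiv.apply_symm_apply]
  rw [e, e]
  conv_rhs => rw [← hI, Finset.powersetCard_map, Finset.sum_map]
  refine Finset.sum_congr rfl fun t _ => ?_
  simp

theorem e_eq_of_last_eq_zero {z : ℕ → Poly} {n : ℕ} (h : z (n + 1) = 0) (i : ℕ) :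
    e z (n + 1) i = e z n i := by
  symm
  apply Finset.sum_subset
  · exact Finset.powersetCard_mono (Finset.Icc_subset_Icc_right (by omega))
  · intro t ht ht'
    apply Finset.prod_eq_zero (i := n + 1) _ h
    by_contra hn
    apply ht'
    rw [Finset.mem_powersetCard] at ht ⊢
    refine ⟨fun j hj => ?_, ht.2⟩
    have := ht.1 hj
    rw [Finset.mem_Icc] at this ⊢
    have : j ≠ n + 1 := by rintro rfl; exact hn hj
    omega

theorem qTilde₂_zero (z : ℕ → Poly) (n i : ℕ) : qTilde₂ z n i 0 = e z n i := by
  simp [qTilde₂, e_zero]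

/-- Every correction term contains some e_{i+h} with i + h > n. -/
theorem qTilde₂_of_le (z : ℕ → Poly) {n i : ℕ} (h : n ≤ i) (j : ℕ) :
    qTilde₂ z n i j = e z n i * e z n j := by
  rw [qTilde₂, Finset.sum_eq_zero, mul_zero, add_zero]
  intro k hk
  rw [Finset.mem_Icc] at hk
  rw [e_of_lt z (by omega : n < i + k)]
  ring

theorem qTilde₂_congr_of_e {z z' : ℕ → Poly} {n n' : ℕ} (h : ∀ i, e z n i = e z' n' i) (i j : ℕ) :
    qTilde₂ z n i j = qTilde₂ z' n' i j := by
  simp [qTilde₂, h]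

theorem map_qTilde₂ (φ : Poly →ₐ[ℤ] Poly) (z : ℕ → Poly) (n i j : ℕ) :
    φ (qTilde₂ z n i j) = qTilde₂ (fun j => φ (z j)) n i j := by
  simp [qTilde₂, map_e, map_ofNat]

/-- The parts of a strict partition, padded by a zero to an even number of parts. -/
def paddedParts (lam : Finset ℕ) : List ℕ :=
  if lam.card % 2 = 0 then lam.sort (· ≥ ·) else lam.sort (· ≥ ·) ++ [0]

theorem ofFn_part (lam : Finset ℕ) :
    List.ofFn (fun i : Fin (2 * ((lam.card + 1) / 2)) => part lam i) = paddedParts lam := by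
  have hc : (lam.sort (· ≥ ·)).length = lam.card := Finset.length_sort _
  rw [paddedParts]
  split_ifs with h
  · apply List.ext_getElem
    · simp; omega
    · intro i h1 h2
      simp [part, List.getElem?_eq_getElem h2]
  · apply List.ext_getElem
    · simp; omega
    · intro i h1 h2
      rw [List.getElem_ofFn, part, List.getElem_append, List.getD_eq_getElem?_getD]
      split_ifs with h3
      · simp [List.getElem?_eq_getElem h3]
      · simp [List.getElem?_eq_none (not_lt.1 h3)]

theorem qTilde_eq_pf (z : ℕ → Poly) (n : ℕ) (lam : Finset ℕ) :
    qTilde z n lam = pf (qTilde₂ z n) (paddedParts lam) := by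
  rw [qTilde, ← ofFn_part]
  exact pfaffian_eq_pf (qTilde₂ z n) _ (fun i : Fin (2 * ((lam.card + 1) / 2)) => part lam i)

theorem qTilde_congr_of_e {z z' : ℕ → Poly} {n n' : ℕ} (h : ∀ i, e z n i = e z' n' i)
    (lam : Finset ℕ) : qTilde z n lam = qTilde z' n' lam := by
  rw [qTilde_eq_pf, qTilde_eq_pf,
    show qTilde₂ z n = qTilde₂ z' n' from funext₂ (qTilde₂_congr_of_e h)]

theorem map_qTilde (φ : Poly →ₐ[ℤ] Poly) (z : ℕ → Poly) (n : ℕ) (lam : Finset ℕ) :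
    φ (qTilde z n lam) = qTilde (fun j => φ (z j)) n lam := by
  rw [qTilde_eq_pf, qTilde_eq_pf]
  refine (map_pf φ.toRingHom _ _).trans ?_
  congr 1
  exact funext₂ (map_qTilde₂ φ z n)

theorem sort_of_max_mem {lam : Finset ℕ} {n : ℕ} (hn : n ∈ lam) (h : ∀ i ∈ lam, i ≤ n) :
    lam.sort (· ≥ ·) = n :: (lam.erase n).sort (· ≥ ·) := by
  have := Finset.sort_insert (r := (· ≥ ·)) (a := n) (s := lam.erase n)
    (fun b hb => h b (Finset.mem_of_mem_erase hb)) (Finset.notMem_erase n lam)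
  rwa [Finset.insert_erase hn] at this

/-- The factorization `Q̃_{n,μ}(z_1, …, z_n) = e_n Q̃_μ(z_1, …, z_n)`. -/
theorem qTilde_of_mem (z : ℕ → Poly) {lam : Finset ℕ} {n : ℕ} (hn : n ∈ lam)
    (h : ∀ i ∈ lam, i ≤ n) :
    qTilde z n lam = e z n n * qTilde z n (lam.erase n) := by
  have hrow : qTilde₂ z n n = fun j => e z n n * e z n j :=
    funext fun j => qTilde₂_of_le z le_rfl j
  have hcol : (fun i => qTilde₂ z n i 0) = e z n := funext (qTilde₂_zero z n)
  have hcard := Finset.card_erase_add_one hn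
  have hl : ((lam.erase n).sort (· ≥ ·)).length = (lam.erase n).card := Finset.length_sort _
  rw [qTilde_eq_pf, qTilde_eq_pf, paddedParts, paddedParts, sort_of_max_mem hn h]
  set l := (lam.erase n).sort (· ≥ ·)
  by_cases hp : (lam.erase n).card % 2 = 0
  -- The padding zero belongs to λ but not to λ without n. Pairing n with it gives the desired term,
  -- since e_0 = 1.
  · rw [if_neg (by omega), if_pos hp, List.cons_append, pf_cons, hrow, contract_const_mul_left,
      contract_concat, Even.neg_one_pow ⟨(lam.erase n).card / 2, by omega⟩, e_zero]
    -- The column of the padding zero is again `e z n`, so these terms contract twice with one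
    -- vector.
    have : contract (e z n) (fun t => pf (qTilde₂ z n) (t ++ [0])) l = 0 := by
      rw [contract_congr (G := contract (e z n) (pf (qTilde₂ z n))), contract_self]
      intro t ht
      rw [pf_concat _ _ (t.length / 2) t (by omega), hcol]
    rw [this]
    ring
  -- Now λ without n is padded, and its expansion along the last column is the same contraction.
  · rw [if_pos (by omega), if_neg hp, pf_cons, hrow, contract_const_mul_left,
      pf_concat _ _ (l.length / 2) l (by omega), hcol]

/-- The row of the largest part is a multiple of e_n(z_1,…,z_m) = 0. -/
theorem qTilde_eq_zero (z : ℕ → Poly) {lam : Finset ℕ} {n m : ℕ} (hn : n ∈ lam)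
    (h : ∀ i ∈ lam, i ≤ n) (hm : m < n) : qTilde z m lam = 0 := by
  have hrow : qTilde₂ z m n = fun _ => 0 :=
    funext fun j => by rw [qTilde₂_of_le z hm.le, e_of_lt z hm, zero_mul]
  rw [qTilde_eq_pf, paddedParts, sort_of_max_mem hn h]
  split_ifs
  · rw [pf_cons, hrow, contract_zero_left]
  · rw [List.cons_append, pf_cons, hrow, contract_zero_left]

/-! ### The kernel -/

theorem act_e_x {i n : ℕ} (h : 1 ≤ i) (h' : i < n) (j : ℕ) :
    e (fun t => act i (x t)) n j = e x n j := by
  obtain ⟨i, rfl⟩ : ∃ q, i = q + 1 := ⟨i - 1, by omega⟩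
  simp only [act_succ_x]
  apply e_comp_perm x n j (Equiv.swap (i + 1) (i + 2))
  intro t
  simp only [Finset.mem_Icc, Equiv.swap_apply_def]
  split_ifs <;> omega

theorem act_qTilde_x {i n : ℕ} (h : 1 ≤ i) (h' : i < n) (lam : Finset ℕ) :
    act i (qTilde x n lam) = qTilde x n lam := by
  rw [map_qTilde, qTilde_congr_of_e (act_e_x h h')]

theorem act_qTilde_y (i n : ℕ) (lam : Finset ℕ) :
    act i (qTilde y n lam) = qTilde y n lam := by
  rw [map_qTilde]
  simp only [act_y]

theorem act_qKernel {i n : ℕ} (h : 1 ≤ i) (h' : i < n) : act i (qKernel n) = qKernel n := by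
  simp only [qKernel, map_sum, map_mul, act_qTilde_x h h', act_qTilde_y]

/-- The part of the kernel which survives `y_{m+1} = 0`, without the factor `x_1 ⋯ x_{m+1}`. -/
def qKernelAux (m : ℕ) : Poly :=
  ∑ lam ∈ (Finset.Icc 1 m).powerset, qTilde x (m + 1) lam * qTilde y m (Finset.Icc 1 m \ lam)

theorem act_qKernelAux {i m : ℕ} (h : 1 ≤ i) (h' : i ≤ m) :
    act i (qKernelAux m) = qKernelAux m := by
  simp only [qKernelAux, map_sum, map_mul, act_qTilde_x h (Nat.lt_succ_of_le h'), act_qTilde_y]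

theorem qTilde_killX (m : ℕ) (lam : Finset ℕ) :
    killX (m + 1) (qTilde x (m + 1) lam) = qTilde x m lam := by
  rw [map_qTilde]
  refine qTilde_congr_of_e (fun i => ?_) lam
  rw [e_eq_of_last_eq_zero (by simp)]
  exact e_congr (fun j _ h => by simp; omega) i

theorem qTilde_killY (m : ℕ) (lam : Finset ℕ) :
    killY (m + 1) (qTilde y (m + 1) lam) = qTilde y m lam := by
  rw [map_qTilde]
  refine qTilde_congr_of_e (fun i => ?_) lam
  rw [e_eq_of_last_eq_zero (by simp)]
  exact e_congr (fun j _ h => by simp; omega) i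

theorem killX_qKernelAux (m : ℕ) : killX (m + 1) (qKernelAux m) = qKernel m := by
  simp only [qKernelAux, qKernel, map_sum, map_mul, qTilde_killX]
  refine Finset.sum_congr rfl fun lam _ => ?_
  rw [map_qTilde]
  simp only [killX_y]

/-- If m+1 is not a part of λ, it is one of λ', and Q̃_{λ'}(Y_m) vanishes. Otherwise Q̃_λ(X_{m+1})
has the factor e_{m+1} = x_1⋯x_{m+1}. -/
theorem killY_qKernel (m : ℕ) : killY (m + 1) (qKernel (m + 1)) = prodX (m + 1) * qKernelAux m := by
  have hI : Finset.Icc 1 (m + 1) = insert (m + 1) (Finset.Icc 1 m) := by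
    ext; simp; omega
  have hm : m + 1 ∉ Finset.Icc 1 m := by simp
  simp only [qKernel, map_sum, map_mul, qTilde_killY]
  rw [hI, Finset.sum_powerset_insert hm, Finset.sum_eq_zero, zero_add, qKernelAux, Finset.mul_sum]
  · refine Finset.sum_congr rfl fun lam hlam => ?_
    rw [Finset.mem_powerset] at hlam
    have hl : m + 1 ∉ lam := fun h => hm (hlam h)
    have hle : ∀ i ∈ insert (m + 1) lam, i ≤ m + 1 := by
      intro i hi
      rcases Finset.mem_insert.1 hi with rfl | hi
      · rfl
      · have := hlam hi
        rw [Finset.mem_Icc] at this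
        omega
    have hd : insert (m + 1) (Finset.Icc 1 m) \ insert (m + 1) lam = Finset.Icc 1 m \ lam := by
      rw [Finset.insert_sdiff_insert, Finset.sdiff_insert_of_notMem hm]
    rw [map_qTilde]
    simp only [killY_x]
    rw [hd, qTilde_of_mem x (Finset.mem_insert_self _ _) hle, Finset.erase_insert hl, e_self, prodX,
      mul_assoc]
  · intro lam hlam
    rw [Finset.mem_powerset] at hlam
    rw [qTilde_eq_zero (n := m + 1) y, mul_zero]
    · rw [Finset.mem_sdiff]
      exact ⟨Finset.mem_insert_self _ _, fun h => hm (hlam h)⟩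
    · intro i hi
      have := (Finset.mem_sdiff.1 hi).1
      rw [← hI, Finset.mem_Icc] at this
      exact this.2
    · omega

/-! ### Inversions and descents -/

/-- Twice the number of inversions of `w ∈ W_n`. -/
def inv (n : ℕ) (w : Equiv.Perm ℤ) : ℕ :=
  ((Finset.Icc (-n : ℤ) n ×ˢ Finset.Icc (-n : ℤ) n).filter
    fun p => p.1 < p.2 ∧ p.1 + p.2 ≠ 0 ∧ w p.2 < w p.1).card

/-- The position `i` is an ascent of `w`. -/
def Asc (w : Equiv.Perm ℤ) : ℕ → Prop
  | 0 => 0 < w 1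
  | i + 1 => w (i + 1 : ℤ) < w (i + 2 : ℤ)

/-- Oddness of a permutation of `ℤ`. -/
def OddPerm (w : Equiv.Perm ℤ) : Prop := ∀ i, w (-i) = -w i

theorem OddPerm.zero {w : Equiv.Perm ℤ} (h : OddPerm w) : w 0 = 0 := by
  have := h 0
  rw [neg_zero] at this
  omega

theorem OddPerm.mul {v w : Equiv.Perm ℤ} (hv : OddPerm v) (hw : OddPerm w) : OddPerm (v * w) := by
  intro i
  simp only [Equiv.Perm.mul_apply, hw i, hv (w i)]

theorem sFun_odd (i : ℕ) : OddPerm (sFun i) := (sFun_mem_W i).1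

theorem odd_of_mem {n : ℕ} {w : Equiv.Perm ℤ} (h : w ∈ W n) : OddPerm w := h.1

/-! ### Values of the generators and relations between them. -/

theorem sFun_sFun (i : ℕ) (j : ℤ) : sFun i (sFun i j) = j := by
  have := sFun_inv i
  rw [inv_eq_iff_mul_eq_one] at this
  rw [← Equiv.Perm.mul_apply, this, Equiv.Perm.one_apply]

theorem mul_sFun_sFun (w : Equiv.Perm ℤ) (i : ℕ) : w * sFun i * sFun i = w := by
  ext j
  simp only [Equiv.Perm.mul_apply, sFun_sFun]

theorem sFun_zero_apply (j : ℤ) : sFun 0 j = if j = 1 then -1 else if j = -1 then 1 else j := by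
  simp only [sFun, Equiv.swap_apply_def]

theorem sFun_succ_apply (i : ℕ) (j : ℤ) : sFun (i + 1) j =
    if j = i + 1 then (i + 2 : ℤ) else if j = i + 2 then (i + 1 : ℤ) else
    if j = -(i + 1) then -(i + 2 : ℤ) else if j = -(i + 2) then -(i + 1 : ℤ) else j := by
  simp only [sFun, Equiv.Perm.mul_apply, Equiv.swap_apply_def]
  split_ifs <;> omega

@[simp] theorem sFun_zero_one : sFun 0 1 = -1 := by simp [sFun_zero_apply]

theorem sFun_zero_of_ne {j : ℤ} (h : j ≠ 1) (h' : j ≠ -1) : sFun 0 j = j := by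
  simp [sFun_zero_apply, h, h']

@[simp] theorem sFun_succ_left (i : ℕ) : sFun (i + 1) (i + 1 : ℤ) = i + 2 := by
  simp [sFun_succ_apply]

@[simp] theorem sFun_succ_right (i : ℕ) : sFun (i + 1) (i + 2 : ℤ) = i + 1 := by
  simp [sFun_succ_apply]

/-- A positive integer other than `i`, `i + 1` is fixed by `s_i`. -/
theorem sFun_of_ne {i : ℕ} {j : ℤ} (hj : 0 < j) (h : j ≠ i) (h' : j ≠ i + 1) : sFun i j = j := by
  rcases i with _ | i
  · exact sFun_zero_of_ne (by simpa using h') (by omega)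
  · rw [sFun_succ_apply]
    push_cast at h h'
    split_ifs <;> omega

theorem sFun_of_abs_ne {i : ℕ} {j : ℤ} (h : |j| ≠ i) (h' : |j| ≠ i + 1) : sFun i j = j := by
  rcases lt_trichotomy j 0 with hj | rfl | hj
  · rw [abs_of_neg hj] at h h'
    have := sFun_of_ne (by omega) h h'
    rw [sFun_odd] at this
    omega
  · exact (sFun_odd i).zero
  · rw [abs_of_pos hj] at h h'
    exact sFun_of_ne hj h h'

theorem abs_sFun {i : ℕ} {j : ℤ} (h : |j| = i ∨ |j| = i + 1) :
    |sFun i j| = i ∨ |sFun i j| = i + 1 := by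
  by_contra hn
  push Not at hn
  have := sFun_of_abs_ne hn.1 hn.2
  rw [sFun_sFun] at this
  rw [← this] at hn
  omega

theorem sFun_comm {i j : ℕ} (h : i + 2 ≤ j) (k : ℤ) :
    sFun i (sFun j k) = sFun j (sFun i k) := by
  by_cases hj : |k| = j ∨ |k| = j + 1
  · have hj' := abs_sFun hj
    rw [sFun_of_abs_ne (i := i) (j := k) (by omega) (by omega),
      sFun_of_abs_ne (i := i) (by omega) (by omega)]
  · have e : sFun j k = k := sFun_of_abs_ne (by omega) (by omega)
    rw [e]
    by_cases hi : |k| = i ∨ |k| = i + 1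
    · have hi' := abs_sFun hi
      rw [sFun_of_abs_ne (i := j) (by omega) (by omega)]
    · rw [sFun_of_abs_ne (i := i) (j := k) (by omega) (by omega), e]

theorem sFun_braid (i : ℕ) (k : ℤ) : sFun (i + 1) (sFun (i + 2) (sFun (i + 1) k)) =
    sFun (i + 2) (sFun (i + 1) (sFun (i + 2) k)) := by
  have h : ∀ t : ℤ, 0 < t → sFun (i + 1) (sFun (i + 2) (sFun (i + 1) t)) =
      sFun (i + 2) (sFun (i + 1) (sFun (i + 2) t)) := by
    intro t ht
    have e1 : sFun (i + 1) (i + 1 : ℤ) = i + 2 := sFun_succ_left i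
    have e2 : sFun (i + 1) (i + 2 : ℤ) = i + 1 := sFun_succ_right i
    have e3 : sFun (i + 1) (i + 3 : ℤ) = i + 3 :=
      sFun_of_ne (by omega) (by push_cast; omega) (by push_cast; omega)
    have f1 : sFun (i + 2) (i + 1 : ℤ) = i + 1 :=
      sFun_of_ne (by omega) (by push_cast; omega) (by push_cast; omega)
    have f2 : sFun (i + 2) (i + 2 : ℤ) = i + 3 := by
      rw [sFun_succ_apply, if_pos (by push_cast; ring)]; push_cast; ring
    have f3 : sFun (i + 2) (i + 3 : ℤ) = i + 2 := by rw [← f2, sFun_sFun]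
    by_cases h1 : t = i + 1
    · rw [h1, e1, f2, e3, f1, e1, f2]
    by_cases h2 : t = i + 2
    · rw [h2, e2, f1, e1, f2, e3, f3]
    by_cases h3 : t = i + 3
    · rw [h3, e3, f3, e2, f1]
    have e0 : sFun (i + 1) t = t := sFun_of_ne ht (by push_cast; omega) (by push_cast; omega)
    have f0 : sFun (i + 2) t = t := sFun_of_ne ht (by push_cast; omega) (by push_cast; omega)
    rw [e0, f0, e0, f0]
  rcases lt_trichotomy k 0 with hk | rfl | hk
  · have := h (-k) (by omega)
    simp only [sFun_odd _ _] at this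
    omega
  · simp only [(sFun_odd _).zero]
  · exact h k hk

theorem sFun_braid_zero (k : ℤ) : sFun 0 (sFun 1 (sFun 0 (sFun 1 k))) =
    sFun 1 (sFun 0 (sFun 1 (sFun 0 k))) := by
  by_cases h1 : |k| = 1
  · rcases (abs_eq (by omega)).1 h1 with rfl | rfl <;> decide
  by_cases h2 : |k| = 2
  · rcases (abs_eq (by omega)).1 h2 with rfl | rfl <;> decide
  by_cases h0 : k = 0
  · subst h0; decide
  have : |k| ≠ 0 := abs_ne_zero.2 h0
  have e0 : sFun 0 k = k := sFun_of_abs_ne (by simpa using this) (by simpa using h1)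
  have e1 : sFun 1 k = k := sFun_of_abs_ne (by simpa using h1) (by push_cast; omega)
  simp only [e0, e1]

theorem sFun_mem_Icc {n i : ℕ} (h : i < n) (j : ℤ) :
    sFun i j ∈ Finset.Icc (-n : ℤ) n ↔ j ∈ Finset.Icc (-n : ℤ) n := by
  rcases i with _ | i
  · rw [sFun_zero_apply, Finset.mem_Icc, Finset.mem_Icc]
    split_ifs <;> omega
  · rw [sFun_succ_apply, Finset.mem_Icc, Finset.mem_Icc]
    split_ifs <;> omega

theorem sFun_add_eq_zero (i : ℕ) (j k : ℤ) : sFun i j + sFun i k = 0 ↔ j + k = 0 := by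
  have h := sFun_odd i
  constructor
  · intro e
    have : sFun i j = sFun i (-k) := by rw [h]; omega
    have := (sFun i).injective this
    omega
  · intro e
    obtain rfl : j = -k := by omega
    rw [h]
    omega

/-- The pairs which are ordered differently by `s_i`. -/
theorem sFun_lt_iff_zero {j k : ℤ} (_ : j + k ≠ 0) :
    sFun 0 j < sFun 0 k ↔ (j = 1 ∧ k = 0) ∨ (j = 0 ∧ k = -1) ∨
      (j < k ∧ ¬ (j = 0 ∧ k = 1) ∧ ¬ (j = -1 ∧ k = 0)) := by
  simp only [sFun_zero_apply]
  split_ifs <;> omega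

theorem sFun_lt_iff_succ (i : ℕ) {j k : ℤ} (_ : j + k ≠ 0) :
    sFun (i + 1) j < sFun (i + 1) k ↔ (j = i + 2 ∧ k = i + 1) ∨ (j = -(i + 1) ∧ k = -(i + 2)) ∨
      (j < k ∧ ¬ (j = i + 1 ∧ k = i + 2) ∧ ¬ (j = -(i + 2) ∧ k = -(i + 1))) := by
  simp only [sFun_succ_apply]
  split_ifs <;> omega

/-- Relabelling positions by s_i leaves w alone and moves s_i into the order condition on positions.
-/
theorem inv_mul_sFun_eq_card {n i : ℕ} (hi : i < n) (w : Equiv.Perm ℤ) :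
    inv n (w * sFun i) = ((Finset.Icc (-n : ℤ) n ×ˢ Finset.Icc (-n : ℤ) n).filter
      fun p => sFun i p.1 < sFun i p.2 ∧ p.1 + p.2 ≠ 0 ∧ w p.2 < w p.1).card := by
  rw [inv]
  refine Finset.card_bij (fun p _ => (sFun i p.1, sFun i p.2)) ?_ ?_ ?_
  · rintro ⟨a, b⟩ h
    rw [Finset.mem_filter, Finset.mem_product] at h ⊢
    simp only [Equiv.Perm.mul_apply, sFun_mem_Icc hi, sFun_sFun, ne_eq, sFun_add_eq_zero] at h ⊢
    exact h
  · rintro ⟨a, b⟩ _ ⟨c, d⟩ _ h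
    simp only [Prod.mk.injEq, (sFun i).injective.eq_iff] at h
    rw [h.1, h.2]
  · rintro ⟨a, b⟩ h
    refine ⟨(sFun i a, sFun i b), ?_, by simp only [sFun_sFun]⟩
    rw [Finset.mem_filter, Finset.mem_product] at h ⊢
    simp only [Equiv.Perm.mul_apply, sFun_sFun, sFun_mem_Icc hi, ne_eq, sFun_add_eq_zero]
    exact h

/-- Pairs are counted together with their mirror images (a,b) ↦ (-b,-a); position 0 accounts for
sign changes. At an ascent exactly one pair and its mirror become inverted, hence the 2. -/
theorem inv_mul_of_asc {n i : ℕ} (hi : i < n) {w : Equiv.Perm ℤ} (hw : OddPerm w) (h : Asc w i) :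
    inv n (w * sFun i) = inv n w + 2 := by
  have hn : (1 : ℤ) ≤ n := by omega
  rw [inv_mul_sFun_eq_card hi, inv]
  rcases i with _ | i
  · have h0 := hw.zero
    have h1 := hw 1
    simp only [Asc] at h
    rw [← Finset.card_pair (a := ((1, 0) : ℤ × ℤ)) (b := (0, -1)) (by simp),
      ← Finset.card_union_of_disjoint]
    · congr 1
      ext ⟨j, k⟩
      simp only [Finset.mem_filter, Finset.mem_product, Finset.mem_union, Finset.mem_insert,
        Finset.mem_singleton, Finset.mem_Icc, Prod.mk.injEq]
      constructor
      · rintro ⟨hm, hs, hne, hlt⟩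
        rw [sFun_lt_iff_zero hne] at hs
        rcases hs with hs | hs | hs
        · exact Or.inr (Or.inl hs)
        · exact Or.inr (Or.inr hs)
        · exact Or.inl ⟨hm, hs.1, hne, hlt⟩
      · rintro (⟨hm, hs, hne, hlt⟩ | ⟨rfl, rfl⟩ | ⟨rfl, rfl⟩)
        · refine ⟨hm, ?_, hne, hlt⟩
          rw [sFun_lt_iff_zero hne]
          refine Or.inr (Or.inr ⟨hs, ?_, ?_⟩) <;> rintro ⟨rfl, rfl⟩ <;> omega
        · rw [sFun_lt_iff_zero (by omega)]
          omega
        · rw [sFun_lt_iff_zero (by omega)]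
          omega
    · rw [Finset.disjoint_left]
      rintro ⟨j, k⟩ hp hq
      simp only [Finset.mem_filter, Finset.mem_insert, Finset.mem_singleton, Prod.mk.injEq]
        at hp hq
      omega
  · have h1 := hw (i + 1)
    have h2 := hw (i + 2)
    simp only [Asc] at h
    rw [← Finset.card_pair (a := ((i + 2, i + 1) : ℤ × ℤ)) (b := (-(i + 1), -(i + 2)))
        (by rw [ne_eq, Prod.mk.injEq]; omega),
      ← Finset.card_union_of_disjoint]
    · congr 1
      ext ⟨j, k⟩
      simp only [Finset.mem_filter, Finset.mem_product, Finset.mem_union, Finset.mem_insert,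
        Finset.mem_singleton, Finset.mem_Icc, Prod.mk.injEq]
      constructor
      · rintro ⟨hm, hs, hne, hlt⟩
        rw [sFun_lt_iff_succ i hne] at hs
        rcases hs with hs | hs | hs
        · exact Or.inr (Or.inl hs)
        · exact Or.inr (Or.inr hs)
        · exact Or.inl ⟨hm, hs.1, hne, hlt⟩
      · rintro (⟨hm, hs, hne, hlt⟩ | ⟨rfl, rfl⟩ | ⟨rfl, rfl⟩)
        · refine ⟨hm, ?_, hne, hlt⟩
          rw [sFun_lt_iff_succ i hne]
          refine Or.inr (Or.inr ⟨hs, ?_, ?_⟩) <;> rintro ⟨rfl, rfl⟩ <;> omega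
        · rw [sFun_lt_iff_succ i (by omega)]
          omega
        · rw [sFun_lt_iff_succ i (by omega)]
          omega
    · rw [Finset.disjoint_left]
      rintro ⟨j, k⟩ hp hq
      simp only [Finset.mem_filter, Finset.mem_insert, Finset.mem_singleton, Prod.mk.injEq]
        at hp hq
      omega

theorem asc_mul_sFun_of_not_asc {i : ℕ} {w : Equiv.Perm ℤ} (hw : OddPerm w) (h : ¬ Asc w i) :
    Asc (w * sFun i) i := by
  rcases i with _ | i
  · have h0 := hw.zero
    have h1 := hw 1
    have h2 : w 1 ≠ w 0 := fun e => by simpa using w.injective e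
    simp only [Asc, Equiv.Perm.mul_apply, sFun_zero_one] at h ⊢
    omega
  · have h2 : w (i + 1) ≠ w (i + 2) := fun e => by simpa using w.injective e
    simp only [Asc, Equiv.Perm.mul_apply, sFun_succ_left, sFun_succ_right] at h ⊢
    omega

theorem inv_mul_of_not_asc {n i : ℕ} (hi : i < n) {w : Equiv.Perm ℤ} (hw : OddPerm w)
    (h : ¬ Asc w i) : inv n (w * sFun i) + 2 = inv n w := by
  have := inv_mul_of_asc hi (hw.mul (sFun_odd i)) (asc_mul_sFun_of_not_asc hw h)
  rw [mul_sFun_sFun] at this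
  exact this.symm

theorem inv_mul_le {n i : ℕ} (hi : i < n) {w : Equiv.Perm ℤ} (hw : OddPerm w) :
    inv n (w * sFun i) ≤ inv n w + 2 := by
  by_cases h : Asc w i
  · exact (inv_mul_of_asc hi hw h).le
  · have := inv_mul_of_not_asc hi hw h
    omega

theorem inv_one (n : ℕ) : inv n 1 = 0 := by
  rw [inv, Finset.card_eq_zero, Finset.filter_eq_empty_iff]
  rintro p _ ⟨h, _, h'⟩
  simp only [Equiv.Perm.one_apply] at h'
  omega

/-! ### Words -/

/-- The product of a word in the generators. -/
def wordProd (a : List ℕ) : Equiv.Perm ℤ := (a.map sFun).prod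

@[simp] theorem wordProd_nil : wordProd [] = 1 := rfl

theorem wordProd_cons (i : ℕ) (a : List ℕ) : wordProd (i :: a) = sFun i * wordProd a := by
  simp [wordProd]

theorem wordProd_append (a b : List ℕ) : wordProd (a ++ b) = wordProd a * wordProd b := by
  simp [wordProd]

theorem wordProd_concat (a : List ℕ) (i : ℕ) : wordProd (a ++ [i]) = wordProd a * sFun i := by
  simp [wordProd]

theorem wordProd_reverse (a : List ℕ) : wordProd a.reverse = (wordProd a)⁻¹ :=
  (prod_sFun_inv a).symm

theorem wordProd_mem {n : ℕ} {a : List ℕ} (ha : ∀ i ∈ a, i < n) : wordProd a ∈ W n :=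
  prod_sFun_mem n a ha

theorem wordProd_odd (a : List ℕ) : OddPerm (wordProd a) := by
  induction a with
  | nil => exact fun i => rfl
  | cons i a ih => rw [wordProd_cons]; exact (sFun_odd i).mul ih

theorem inv_mul_wordProd_le {n : ℕ} {w : Equiv.Perm ℤ} (hw : OddPerm w) {a : List ℕ}
    (ha : ∀ i ∈ a, i < n) : inv n (w * wordProd a) ≤ inv n w + 2 * a.length := by
  induction a using List.reverseRecOn with
  | nil => simp
  | append_singleton a i ih =>
    rw [wordProd_concat, ← mul_assoc, List.length_append, List.length_singleton]
    have h1 := ih fun j hj => ha j (List.mem_append_left _ hj)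
    have h2 := inv_mul_le (ha i (by simp)) (hw.mul (wordProd_odd a))
    omega

theorem inv_wordProd_le {n : ℕ} {a : List ℕ} (ha : ∀ i ∈ a, i < n) :
    inv n (wordProd a) ≤ 2 * a.length := by
  have := inv_mul_wordProd_le (w := 1) (fun _ => rfl) ha
  rwa [one_mul, inv_one, zero_add] at this

theorem abs_apply_le {n : ℕ} {w : Equiv.Perm ℤ} (hw : w ∈ W n) {i : ℤ} (hi : |i| ≤ n) :
    |w i| ≤ n := by
  by_contra h
  push Not at h
  have := w.injective (hw.2 _ h)
  rw [this] at h
  omega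

/-- Odd permutations of `ℤ` are determined by their values on positive integers. -/
theorem odd_ext {v w : Equiv.Perm ℤ} (hv : OddPerm v) (hw : OddPerm w)
    (h : ∀ i : ℕ, v (i + 1 : ℤ) = w (i + 1 : ℤ)) : v = w := by
  have hpos : ∀ j : ℤ, 0 < j → v j = w j := by
    intro j hj
    obtain ⟨q, rfl⟩ : ∃ q : ℕ, j = q + 1 := ⟨(j - 1).toNat, by omega⟩
    exact h q
  ext j
  rcases lt_trichotomy j 0 with hj | rfl | hj
  · have := hpos (-j) (by omega)
    rw [hv, hw] at this
    omega
  · rw [hv.zero, hw.zero]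
  · exact hpos j hj

/-- The values at 1,…,n are positive, strictly increasing and at most n: counting up from 1 bounds
them below, counting down from n bounds them above. -/
theorem eq_one_of_asc {n : ℕ} {w : Equiv.Perm ℤ} (hw : w ∈ W n) (h : ∀ i < n, Asc w i) :
    w = 1 := by
  refine odd_ext hw.1 (fun _ => rfl) fun i => ?_
  rw [Equiv.Perm.one_apply]
  by_cases hi : n ≤ i
  · exact hw.2 _ (by rw [abs_of_nonneg] <;> omega)
  have hlow : ∀ j : ℕ, j < n → (j + 1 : ℤ) ≤ w (j + 1 : ℤ) := by
    intro j
    induction j with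
    | zero => intro hj; have := h 0 hj; simp only [Asc] at this; rw [Nat.cast_zero, zero_add]; omega
    | succ j ih =>
      intro hj
      have h1 := h (j + 1) hj
      have h2 := ih (by omega)
      simp only [Asc] at h1
      push_cast
      rw [add_assoc, one_add_one_eq_two]
      omega
  have hup : ∀ d : ℕ, ∀ j : ℕ, j + d + 1 = n → w (j + 1 : ℤ) ≤ j + 1 := by
    intro d
    induction d with
    | zero =>
      intro j hj
      have := abs_apply_le hw (i := (j + 1 : ℤ)) (by rw [abs_of_nonneg] <;> omega)
      have := le_abs_self (w (j + 1 : ℤ))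
      omega
    | succ d ih =>
      intro j hj
      have h1 := h (j + 1) (by omega)
      have h2 := ih (j + 1) (by omega)
      simp only [Asc] at h1
      push_cast at h2
      rw [add_assoc, one_add_one_eq_two] at h2
      omega
  exact le_antisymm (hup (n - 1 - i) i (by omega)) (hlow i (by omega))

/-- Descents are removed one at a time. Allowing a counting window n larger than m makes inversion
counts in different ranks comparable. -/
theorem exists_word_length_eq {m n : ℕ} (hmn : m ≤ n) {w : Equiv.Perm ℤ} (hw : w ∈ W m) :
    ∃ a : List ℕ, (∀ i ∈ a, i < m) ∧ wordProd a = w ∧ 2 * a.length = inv n w := by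
  induction hN : inv n w using Nat.strong_induction_on generalizing w with
  | _ N ih =>
    by_cases h : ∀ i < m, Asc w i
    · obtain rfl := eq_one_of_asc hw h
      rw [inv_one] at hN
      exact ⟨[], by simp, rfl, by simpa using hN⟩
    · push Not at h
      obtain ⟨i, hi, hd⟩ := h
      have h1 := inv_mul_of_not_asc (hi.trans_le hmn) hw.1 hd
      obtain ⟨a, ha, hp, hl⟩ := ih _ (by omega)
        (mul_mem hw (W_mono (Nat.succ_le_of_lt hi) (sFun_mem_W i))) rfl
      refine ⟨a ++ [i], ?_, ?_, ?_⟩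
      · intro j hj
        rcases List.mem_append.1 hj with hj | hj
        · exact ha j hj
        · rw [List.mem_singleton.1 hj]; exact hi
      · rw [wordProd_concat, hp, mul_sFun_sFun]
      · rw [List.length_append, List.length_singleton]
        omega

theorem isWord_iff {I : Set ℕ} {w : Winf} {a : List ℕ} :
    IsWord I w a ↔ (∀ i ∈ a, i ∈ I) ∧ wordProd a = w.1 := by
  rw [IsWord, and_congr_right_iff]
  intro _
  rw [Subtype.ext_iff, Subgroup.val_list_prod, List.map_map]
  rfl

/-- `inv_wordProd_le` bounds the length of every word below, and `exists_word_length_eq` attains the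
bound. -/
theorem isReduced_iff {n : ℕ} {w : W n} {a : List ℕ} :
    IsReduced n w a ↔ (∀ i ∈ a, i < n) ∧ wordProd a = w.1 ∧ 2 * a.length = inv n w.1 := by
  obtain ⟨b, hb, hbp, hbl⟩ := exists_word_length_eq le_rfl w.2
  rw [IsReduced]
  simp only [isWord_iff]
  constructor
  · rintro ⟨⟨h1, h2⟩, h3⟩
    have h2' : wordProd a = w.1 := h2
    have h4 := h3 b ⟨hb, hbp⟩
    have h5 := inv_wordProd_le (n := n) h1
    rw [h2'] at h5
    exact ⟨h1, h2, by omega⟩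
  · rintro ⟨h1, h2, h3⟩
    refine ⟨⟨h1, h2⟩, fun c hc => ?_⟩
    have h4 := inv_wordProd_le (n := n) hc.1
    have h5 : wordProd c = w.1 := hc.2
    rw [h5] at h4
    omega

theorem two_mul_length {m n : ℕ} (hmn : m ≤ n) {w : Winf} (hw : w.1 ∈ W m) :
    2 * length w = inv n w.1 := by
  obtain ⟨b, hb, hbp, hbl⟩ := exists_word_length_eq hmn hw
  have hmem : b.length ∈ {r | ∃ a : List ℕ, IsWord Set.univ w a ∧ a.length = r} :=
    ⟨b, isWord_iff.2 ⟨fun _ _ => trivial, hbp⟩, rfl⟩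
  apply le_antisymm
  · rw [← hbl]
    exact Nat.mul_le_mul_left 2 (Nat.sInf_le hmem)
  · obtain ⟨a, ha, hal⟩ := Nat.sInf_mem ⟨_, hmem⟩
    -- A shortest word in W_∞ might use generators outside W_n, so it is compared in a window
    -- containing all its letters.
    obtain ⟨N, hN⟩ : ∃ N, ∀ i ∈ a, i < N :=
      ⟨a.sum + 1, fun i hi => Nat.lt_succ_of_le (List.le_sum_of_mem hi)⟩
    have h1 := inv_wordProd_le (n := max N m) fun i hi => (hN i hi).trans_le (le_max_left _ _)
    rw [(isWord_iff.1 ha).2] at h1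
    obtain ⟨c, hc, hcp, hcl⟩ := exists_word_length_eq (le_max_right N m) hw
    have h2 := inv_wordProd_le (n := n) fun i hi => (hc i hi).trans_le hmn
    rw [hcp] at h2
    have hal' : a.length = length w := hal
    omega

theorem inv_inv {n : ℕ} {w : Equiv.Perm ℤ} (hw : w ∈ W n) : inv n w⁻¹ = inv n w := by
  have key : ∀ {w : Equiv.Perm ℤ}, w ∈ W n → inv n w⁻¹ ≤ inv n w := by
    intro w hw
    obtain ⟨a, ha, hp, hl⟩ := exists_word_length_eq le_rfl hw
    have := inv_wordProd_le (n := n) (a := a.reverse) fun i hi => ha i (List.mem_reverse.1 hi)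
    rw [wordProd_reverse, hp, List.length_reverse] at this
    omega
  apply le_antisymm (key hw)
  simpa using key (inv_mem hw)

/-! ### Independence of the reduced decomposition -/

theorem odd_and_inv_mul_of_not_asc {n i : ℕ} {w : Equiv.Perm ℤ} (hw : OddPerm w) (hi : i < n)
    (h : ¬ Asc w i) : OddPerm (w * sFun i) ∧ inv n (w * sFun i) + 2 = inv n w :=
  ⟨hw.mul (sFun_odd _), inv_mul_of_not_asc hi hw h⟩

/-- The words `p ++ [i]` and `q ++ [j]` are the two sides of a braid relation, and they can be
split off from an element with descents at `i` and `j`. -/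
def IsBraid (i j : ℕ) (p q : List ℕ) : Prop :=
  (∀ t ∈ p, t ≤ j) ∧ (∀ t ∈ q, t ≤ j) ∧ p.length = q.length ∧
    wordProd (p ++ [i]) = wordProd (q ++ [j]) ∧
    (∀ f, ddWord' (p ++ [i]) f = ddWord' (q ++ [j]) f) ∧
    ∀ n w, j < n → OddPerm w → ¬ Asc w i → ¬ Asc w j →
      inv n (w * wordProd (p ++ [i]).reverse) + 2 * (p.length + 1) = inv n w

theorem isBraid_of_far {i j : ℕ} (hij : i + 2 ≤ j) : IsBraid i j [j] [i] := by
  refine ⟨by simp, by simp; omega, rfl, ?_, fun f => (dd'_comm hij f).symm, ?_⟩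
  · ext k
    simp [wordProd, sFun_comm hij]
  · intro n w hn hw hi hj
    obtain ⟨h1, h2⟩ := odd_and_inv_mul_of_not_asc hw (by omega : i < n) hi
    have hj' : ¬ Asc (w * sFun i) j := by
      obtain ⟨j, rfl⟩ : ∃ q, j = q + 1 := ⟨j - 1, by omega⟩
      simp only [Asc, Equiv.Perm.mul_apply] at hj ⊢
      rwa [sFun_of_ne (by omega) (by omega) (by omega),
        sFun_of_ne (by omega) (by omega) (by omega)]
    obtain ⟨h3, h4⟩ := odd_and_inv_mul_of_not_asc h1 hn hj'
    have : wordProd ([j] ++ [i]).reverse = sFun i * sFun j := by simp [wordProd]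
    rw [this, ← mul_assoc, List.length_singleton]
    omega

theorem isBraid_zero : IsBraid 0 1 [1, 0, 1] [0, 1, 0] := by
  refine ⟨by simp, by simp, rfl, ?_, fun f => (dd'_braid_zero f).symm, ?_⟩
  · ext k
    simp [wordProd, sFun_braid_zero]
  · intro n w hn hw hi hj
    have hj0 : ¬ w 1 < w 2 := hj
    have hi0 : ¬ 0 < w 1 := hi
    have hne : w 1 ≠ w 2 := fun e => by simpa using w.injective e
    have hne0 : w 1 ≠ w 0 := fun e => by simpa using w.injective e
    have w0 := hw.zero
    have w1 := hw 1
    have w2 := hw 2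
    have s01 : sFun 0 1 = -1 := by decide
    have s02 : sFun 0 2 = 2 := by decide
    have s11 : sFun 1 1 = 2 := by decide
    have s12 : sFun 1 2 = 1 := by decide
    have s01' : sFun 0 (-1) = 1 := by decide
    have s11' : sFun 1 (-1) = -2 := by decide
    have s02' : sFun 0 (-2) = -2 := by decide
    obtain ⟨h1, e1⟩ := odd_and_inv_mul_of_not_asc (n := n) (i := 0) hw (by omega) hi
    obtain ⟨h2, e2⟩ := odd_and_inv_mul_of_not_asc (n := n) (i := 1) h1 (by omega) (by
      change ¬ w (sFun 0 1) < w (sFun 0 2)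
      rw [s01, s02]; omega)
    obtain ⟨h3, e3⟩ := odd_and_inv_mul_of_not_asc (n := n) (i := 0) h2 (by omega) (by
      change ¬ 0 < w (sFun 0 (sFun 1 1))
      rw [s11, s02]; omega)
    obtain ⟨h4, e4⟩ := odd_and_inv_mul_of_not_asc (n := n) (i := 1) h3 (by omega) (by
      change ¬ w (sFun 0 (sFun 1 (sFun 0 1))) < w (sFun 0 (sFun 1 (sFun 0 2)))
      rw [s01, s02, s11', s12, s02', s01]; omega)
    have : wordProd ([1, 0, 1] ++ [0]).reverse = sFun 0 * (sFun 1 * (sFun 0 * sFun 1)) := by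
      simp [wordProd]
    rw [this, ← mul_assoc, ← mul_assoc, ← mul_assoc]
    simp only [List.length_cons, List.length_nil]
    omega

theorem isBraid_succ (i : ℕ) : IsBraid (i + 1) (i + 2) [i + 1, i + 2] [i + 2, i + 1] := by
  refine ⟨by simp, by simp, rfl, ?_, fun f => dd'_braid i f, ?_⟩
  · ext k
    simp [wordProd, sFun_braid]
  · intro n w hn hw hi hj
    have c1 : ((i + 1 : ℕ) : ℤ) + 1 = i + 2 := by push_cast; ring
    have c2 : ((i + 1 : ℕ) : ℤ) + 2 = i + 3 := by push_cast; ring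
    have hi0 : ¬ w (i + 1) < w (i + 2) := hi
    have hj0 : ¬ w (i + 2) < w (i + 3) := by
      have : ¬ w ((i + 1 : ℕ) + 1) < w ((i + 1 : ℕ) + 2) := hj
      rwa [c1, c2] at this
    have hne : w (i + 1) ≠ w (i + 2) := fun e => by simpa using w.injective e
    have hne' : w (i + 2) ≠ w (i + 3) := fun e => by simpa using w.injective e
    have s1 : sFun (i + 1) (i + 1 : ℤ) = i + 2 := sFun_succ_left i
    have s2 : sFun (i + 1) (i + 2 : ℤ) = i + 1 := sFun_succ_right i
    have s3 : sFun (i + 1) (i + 3 : ℤ) = i + 3 :=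
      sFun_of_ne (by omega) (by push_cast; omega) (by push_cast; omega)
    have t1 : sFun (i + 2) (i + 1 : ℤ) = i + 1 :=
      sFun_of_ne (by omega) (by push_cast; omega) (by push_cast; omega)
    have t2 : sFun (i + 2) (i + 2 : ℤ) = i + 3 := by
      rw [sFun_succ_apply, if_pos (by push_cast; ring)]; push_cast; ring
    obtain ⟨h1, e1⟩ := odd_and_inv_mul_of_not_asc (n := n) (i := i + 1) hw (by omega) hi
    obtain ⟨h2, e2⟩ := odd_and_inv_mul_of_not_asc (n := n) (i := i + 2) h1 (by omega) (by
      change ¬ w (sFun (i + 1) ((i + 1 : ℕ) + 1)) < w (sFun (i + 1) ((i + 1 : ℕ) + 2))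
      rw [c1, c2, s2, s3]; omega)
    obtain ⟨h3, e3⟩ := odd_and_inv_mul_of_not_asc (n := n) (i := i + 1) h2 (by omega) (by
      change ¬ w (sFun (i + 1) (sFun (i + 2) (i + 1))) <
        w (sFun (i + 1) (sFun (i + 2) (i + 2)))
      rw [t1, t2, s1, s3]; omega)
    have : wordProd ([i + 1, i + 2] ++ [i + 1]).reverse =
        sFun (i + 1) * (sFun (i + 2) * sFun (i + 1)) := by simp [wordProd]
    rw [this, ← mul_assoc, ← mul_assoc]
    simp only [List.length_cons, List.length_nil]
    omega

theorem exists_isBraid {i j : ℕ} (h : i < j) : ∃ p q : List ℕ, IsBraid i j p q := by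
  by_cases hij : i + 2 ≤ j
  · exact ⟨_, _, isBraid_of_far hij⟩
  obtain rfl : j = i + 1 := by omega
  rcases i with _ | i
  · exact ⟨_, _, isBraid_zero⟩
  · exact ⟨_, _, isBraid_succ i⟩

/-- A word in `s_0, …, s_{n-1}` whose length is that of its product. -/
def RedWord (n : ℕ) (a : List ℕ) : Prop :=
  (∀ i ∈ a, i < n) ∧ 2 * a.length = inv n (wordProd a)

theorem RedWord.of_concat {n : ℕ} {a : List ℕ} {i : ℕ} (h : RedWord n (a ++ [i])) :
    RedWord n a ∧ ¬ Asc (wordProd (a ++ [i])) i := by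
  obtain ⟨h1, h2⟩ := h
  have h1' : ∀ j ∈ a, j < n := fun j hj => h1 j (List.mem_append_left _ hj)
  have hi : i < n := h1 i (by simp)
  have h3 := inv_wordProd_le h1'
  have h4 := inv_mul_le hi (wordProd_odd a)
  rw [List.length_append, List.length_singleton, wordProd_concat] at h2
  refine ⟨⟨h1', by omega⟩, fun hasc => ?_⟩
  have h5 := inv_mul_of_asc hi (wordProd_odd _) hasc
  rw [wordProd_concat, mul_sFun_sFun] at h5
  omega

/-- The operator of a reduced word only depends on the product of the word. -/
theorem RedWord.ddWord'_eq {n : ℕ} {a b : List ℕ} (ha : RedWord n a) (hb : RedWord n b)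
    (hab : wordProd a = wordProd b) (f : Poly) : ddWord' a f = ddWord' b f := by
  induction hN : a.length using Nat.strong_induction_on generalizing a b f with
  | _ N ih =>
    have hlen : a.length = b.length := by
      have h1 := ha.2
      have h2 := hb.2
      rw [hab] at h1
      omega
    rcases List.eq_nil_or_concat a with rfl | ⟨a, i, rfl⟩
    · rw [List.length_nil] at hlen
      rw [List.length_eq_zero_iff.1 hlen.symm]
    rcases List.eq_nil_or_concat b with rfl | ⟨b, j, rfl⟩
    · simp at hlen
    rw [List.concat_eq_append] at *
    rw [List.concat_eq_append] at *
    rw [List.length_append, List.length_singleton] at hN hlen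
    rw [List.length_append, List.length_singleton] at hlen
    obtain ⟨ha', hai⟩ := ha.of_concat
    obtain ⟨hb', hbj⟩ := hb.of_concat
    by_cases hij : i = j
    · subst hij
      rw [ddWord'_append, ddWord'_append]
      refine ih a.length (by omega) ha' hb' ?_ _ rfl
      rwa [wordProd_concat, wordProd_concat, mul_left_inj] at hab
    have main : ∀ {a b : List ℕ} {i j : ℕ} (_ : i < j) (_ : a.length < N) (_ : b.length < N)
        (_ : RedWord n (a ++ [i])) (_ : RedWord n (b ++ [j]))
        (_ : wordProd (a ++ [i]) = wordProd (b ++ [j])),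
        ddWord' (a ++ [i]) f = ddWord' (b ++ [j]) f := by
      clear hab hlen hN ha hb ha' hb' hai hbj hij
      clear a b i j
      intro a b i j hij haN hbN ha hb hab
      obtain ⟨ha', hai⟩ := ha.of_concat
      obtain ⟨hb', hbj⟩ := hb.of_concat
      rw [← hab] at hbj
      have hj : j < n := hb.1 j (by simp)
      obtain ⟨p, q, hp, hq, hpq, hprod, hdd, hinv⟩ := exists_isBraid hij
      have hinv := hinv n _ hj (wordProd_odd _) hai hbj
      -- Having descents at i and j, the element is u times the longest element of the dihedral
      -- group they generate, with lengths adding. A reduced word c of u extends to reduced words c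
      -- ++ p and c ++ q for the products of a and b; induction replaces a and b by these, and one
      -- braid relation concludes.
      set u := wordProd (a ++ [i]) * wordProd (p ++ [i]).reverse with hu
      have hp' : ∀ t ∈ p, t < n := fun t ht => (hp t ht).trans_lt hj
      have hq' : ∀ t ∈ q, t < n := fun t ht => (hq t ht).trans_lt hj
      have huW : u ∈ W n := mul_mem (wordProd_mem ha.1) (wordProd_mem fun t ht => by
        rcases List.mem_append.1 (List.mem_reverse.1 ht) with h | h
        · exact hp' t h
        · rw [List.mem_singleton.1 h]; omega)
      obtain ⟨c, hc, hcu, hcl⟩ := exists_word_length_eq le_rfl huW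
      have hcp : wordProd (c ++ p) = wordProd a := by
        have : wordProd c * wordProd (p ++ [i]) = wordProd (a ++ [i]) := by
          rw [hcu, hu, wordProd_reverse, inv_mul_cancel_right]
        rwa [wordProd_concat, wordProd_concat, ← mul_assoc, mul_left_inj, ← wordProd_append] at this
      have hcq : wordProd (c ++ q) = wordProd b := by
        have : wordProd c * wordProd (q ++ [j]) = wordProd (b ++ [j]) := by
          rw [hcu, hu, wordProd_reverse, hprod, inv_mul_cancel_right, hab]
        rwa [wordProd_concat, wordProd_concat, ← mul_assoc, mul_left_inj, ← wordProd_append] at this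
      have hcpR : RedWord n (c ++ p) := by
        refine ⟨fun t ht => ?_, ?_⟩
        · rcases List.mem_append.1 ht with h | h
          · exact hc t h
          · exact hp' t h
        · rw [hcp, ← ha'.2, List.length_append]
          have := ha.2
          rw [List.length_append, List.length_singleton] at this
          omega
      have hcqR : RedWord n (c ++ q) := by
        refine ⟨fun t ht => ?_, ?_⟩
        · rcases List.mem_append.1 ht with h | h
          · exact hc t h
          · exact hq' t h
        · rw [hcq, ← hb'.2, List.length_append]
          have := hb.2
          rw [← hab, List.length_append, List.length_singleton] at this
          omega
      rw [ddWord'_append a, ddWord'_append b, ih a.length haN ha' hcpR hcp.symm _ rfl,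
        ih b.length hbN hb' hcqR hcq.symm _ rfl, ← ddWord'_append, ← ddWord'_append,
        List.append_assoc, List.append_assoc, ddWord'_append c, ddWord'_append c, hdd]
    rcases lt_or_gt_of_ne hij with h | h
    · exact main h (by omega) (by omega) ha hb hab
    · exact (main h (by omega) (by omega) hb ha hab.symm).symm

/-- Frees ∂'_w from the word chosen in its definition. -/
theorem ddW'_eq {n : ℕ} {w : W n} {a : List ℕ} (ha : RedWord n a) (hw : wordProd a = w.1)
    (f : Poly) : ddW' n w f = ddWord' a f := by
  obtain ⟨h1, h2, h3⟩ := isReduced_iff.1 (Classical.choose_spec (exists_isReduced n w))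
  exact RedWord.ddWord'_eq ⟨h1, by rw [h2, h3]⟩ ha (h2.trans hw.symm) f

/-! ### Maximal Grassmannian elements -/

theorem coe_wRho_apply (k : ℕ) (i : ℤ) : (wRho k).1 i = wRhoFun k i := rfl

theorem coe_w₀_apply (n : ℕ) (i : ℤ) : (w₀ n).1 i = w₀Fun n i := rfl

theorem wRho_mem (k : ℕ) : (wRho k).1 ∈ W k := by
  refine ⟨fun i => ?_, fun i hi => ?_⟩
  · simp only [coe_wRho_apply, wRhoFun]
    split_ifs <;> omega
  · rw [lt_abs] at hi
    simp only [coe_wRho_apply, wRhoFun]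
    split_ifs <;> omega

theorem wRho_inv (k : ℕ) : (wRho k).1⁻¹ = (wRho k).1 := by
  rw [inv_eq_iff_mul_eq_one]
  ext i
  exact wRhoFun_involutive k i

theorem asc_wRho {k i : ℕ} (hi : 1 ≤ i) : Asc (wRho k).1 i := by
  obtain ⟨i, rfl⟩ : ∃ q, i = q + 1 := ⟨i - 1, by omega⟩
  simp only [Asc, coe_wRho_apply, wRhoFun]
  split_ifs <;> omega

theorem wordProd_downWord (k i : ℕ) : wordProd (downWord k) (i + 1 : ℤ) =
    if i = 0 then (k + 1 : ℤ) else if i ≤ k then (i : ℤ) else (i + 1 : ℤ) := by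
  induction k with
  | zero =>
    simp only [downWord, wordProd_nil, Equiv.Perm.one_apply]
    split_ifs <;> omega
  | succ k ih =>
    rw [downWord, wordProd_cons, Equiv.Perm.mul_apply, ih, sFun_succ_apply]
    push_cast
    split_ifs <;> omega

theorem wordProd_longWord (k i : ℕ) : wordProd (longWord k) (i + 1 : ℤ) =
    if i < k then (k - i : ℤ) else (i + 1 : ℤ) := by
  induction k generalizing i with
  | zero => simp [longWord]
  | succ k ih =>
    rw [longWord, wordProd_append, Equiv.Perm.mul_apply, wordProd_downWord]
    rcases i with _ | i
    · rw [if_pos rfl, ih]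
      push_cast
      split_ifs <;> omega
    · rw [if_neg (by omega)]
      split_ifs with h1 h2 h2
      · push_cast
        rw [ih]
        split_ifs <;> omega
      · omega
      · omega
      · have := ih (i + 1)
        rw [this, if_neg (by omega)]

theorem wRho_mul_longWord (n : ℕ) : (wRho n).1 * wordProd (longWord n) = (w₀ n).1 := by
  refine odd_ext ((odd_of_mem (wRho_mem n)).mul (wordProd_odd _)) (w₀ n).2.1 fun i => ?_
  rw [Equiv.Perm.mul_apply, wordProd_longWord, coe_wRho_apply, coe_w₀_apply, w₀Fun, wRhoFun,
    abs_of_nonneg (by omega)]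
  split_ifs <;> omega

theorem wRho_mul_downWord (m : ℕ) :
    (wRho m).1 * wordProd (downWord m ++ [0]) = (wRho (m + 1)).1 := by
  refine odd_ext ((odd_of_mem (wRho_mem m)).mul (wordProd_odd _)) (wRho_mem (m + 1)).1 fun i => ?_
  rw [Equiv.Perm.mul_apply, wordProd_concat, Equiv.Perm.mul_apply]
  rcases i with _ | i
  · have := wordProd_downWord m 0
    simp only [Nat.cast_zero, zero_add, if_true] at this ⊢
    rw [sFun_zero_one, wordProd_odd, this, coe_wRho_apply, coe_wRho_apply, wRhoFun, wRhoFun,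
      if_neg (by omega), if_neg (by omega), if_pos (by omega)]
    push_cast
    ring
  · rw [sFun_zero_of_ne (by omega) (by omega), wordProd_downWord, coe_wRho_apply, coe_wRho_apply,
      wRhoFun, wRhoFun]
    push_cast
    split_ifs <;> omega

/-! ### Ascending chains -/

/-- The large entry at position k+1 moves left to position 1, crossing a smaller entry at each step.
-/
theorem inv_mul_downWord {n k : ℕ} (hk : k < n) {g : Equiv.Perm ℤ} (hg : OddPerm g)
    (h : ∀ i : ℕ, i < k → g (i + 1 : ℤ) < g (k + 1 : ℤ)) :
    inv n (g * wordProd (downWord k)) = inv n g + 2 * k := by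
  induction k generalizing g with
  | zero => simp [downWord]
  | succ k ih =>
    have hasc : Asc g (k + 1) := by
      have := h k (by omega)
      push_cast at this
      rwa [add_assoc, one_add_one_eq_two] at this
    rw [downWord, wordProd_cons, ← mul_assoc, ih (by omega) (hg.mul (sFun_odd _)),
      inv_mul_of_asc hk hg hasc]
    · ring
    · intro i hi
      have := h i (by omega)
      push_cast at this
      rw [Equiv.Perm.mul_apply, Equiv.Perm.mul_apply, sFun_succ_left,
        sFun_of_ne (by omega) (by push_cast; omega) (by push_cast; omega)]
      rwa [add_assoc (k : ℤ), one_add_one_eq_two] at this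

/-- Reversing the first k entries keeps them below the next one, so every descending block is a
chain of ascents. -/
theorem inv_mul_longWord {n k : ℕ} (hk : k ≤ n) {g : Equiv.Perm ℤ} (hg : OddPerm g)
    (h : ∀ i j : ℕ, i < j → j < k → g (i + 1 : ℤ) < g (j + 1 : ℤ)) :
    inv n (g * wordProd (longWord k)) = inv n g + 2 * (longWord k).length := by
  induction k with
  | zero => simp [longWord]
  | succ k ih =>
    rw [longWord, wordProd_append, ← mul_assoc,
      inv_mul_downWord (by omega) (hg.mul (wordProd_odd _)),
      ih (by omega) fun i j hij hj => h i j hij (by omega), List.length_append, length_downWord]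
    · ring
    · intro i hi
      rw [Equiv.Perm.mul_apply, Equiv.Perm.mul_apply, wordProd_longWord, wordProd_longWord,
        if_pos hi, if_neg (lt_irrefl k)]
      have := h (k - i - 1) k (by omega) (by omega)
      rwa [show ((k - i - 1 : ℕ) : ℤ) + 1 = k - i by omega] at this

/-- `v` is increasing on the positive integers. -/
def IncPos (v : Equiv.Perm ℤ) : Prop := ∀ i : ℕ, v (i + 1 : ℤ) < v (i + 2 : ℤ)

theorem IncPos.lt {v : Equiv.Perm ℤ} (h : IncPos v) {i j : ℕ} (hij : i < j) :
    v (i + 1 : ℤ) < v (j + 1 : ℤ) := by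
  have : StrictMono fun i : ℕ => v (i + 1 : ℤ) := strictMono_nat_of_lt_succ fun i => by
    have := h i
    push_cast
    rwa [add_assoc (i : ℤ), one_add_one_eq_two]
  exact this hij

theorem IncPos.mul_wRho_lt {v : Equiv.Perm ℤ} (hv : OddPerm v) (h : IncPos v) {n i j : ℕ}
    (hij : i < j) (hj : j < n) :
    (v * (wRho n).1) (i + 1 : ℤ) < (v * (wRho n).1) (j + 1 : ℤ) := by
  have hval : ∀ i : ℕ, i < n →
      (v * (wRho n).1) (i + 1 : ℤ) = -v ((n - 1 - i : ℕ) + 1 : ℤ) := by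
    intro i hi
    rw [Equiv.Perm.mul_apply, coe_wRho_apply, wRhoFun, if_pos (by omega), hv,
      show (n : ℤ) + 1 - (i + 1) = ((n - 1 - i : ℕ) + 1 : ℤ) by omega]
  rw [hval i (by omega), hval j hj]
  exact neg_lt_neg (h.lt (by omega))

/-- For `w ∈ W_n` with `w⁻¹` increasing on the positive integers, the double Schubert polynomial is
obtained from the kernel by the divided differences along a reduced word of `w⁻¹ w_{ρ_n}`. -/
theorem schubertC_eq {n : ℕ} {w : W n} (hw : IncPos w.1⁻¹) {d : List ℕ} (hd : RedWord n d)
    (hdp : wordProd d = w.1⁻¹ * (wRho n).1) : schubertC n w = ddWord' d (qKernel n) := by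
  have hodd : OddPerm w.1⁻¹ := (inv_mem w.2).1
  have hp : wordProd (d ++ longWord n) = (w⁻¹ * w₀ n).1 := by
    rw [wordProd_append, hdp, mul_assoc, wRho_mul_longWord]
    rfl
  have hR : RedWord n (d ++ longWord n) := by
    refine ⟨fun i hi => ?_, ?_⟩
    · rcases List.mem_append.1 hi with h | h
      · exact hd.1 i h
      · exact (mem_longWord h).2
    · rw [wordProd_append, inv_mul_longWord le_rfl (wordProd_odd _), ← hd.2, List.length_append]
      · ring
      · intro i j hij hj
        rw [hdp]
        exact hw.mul_wRho_lt hodd hij hj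
  -- The sign from stripping Δ cancels the sign in the definition of ℭ_w.
  rw [schubertC, ddW'_eq hR hp, ddWord'_append,
    ddWord'_longWord_vdm n fun i h h' => act_qKernel h h', ddWord'_mul_of_invariant (by simp),
    ← mul_assoc, ← pow_add, Even.neg_one_pow ⟨_, rfl⟩, one_mul]

/-- The product of d fixes m+1, its largest entry among the first m+1. The descending word brings
this entry to position 1, where it is positive, so s_0 is again an ascent. -/
theorem RedWord.append_downWord {m : ℕ} {d : List ℕ} (hd : RedWord m d)
    (hd' : RedWord (m + 1) d)
    (hlt : ∀ i : ℕ, i < m → wordProd d (i + 1 : ℤ) < wordProd d (m + 1 : ℤ)) :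
    RedWord (m + 1) (d ++ (downWord m ++ [0])) := by
  have hmW := wordProd_mem hd.1
  refine ⟨fun i hi => ?_, ?_⟩
  · rcases List.mem_append.1 hi with h | h
    · exact hd'.1 i h
    · rcases List.mem_append.1 h with h | h
      · have := (mem_downWord h).2
        omega
      · rw [List.mem_singleton.1 h]; omega
  · rw [← List.append_assoc, wordProd_concat, inv_mul_of_asc (by omega) (wordProd_odd _),
      wordProd_append, inv_mul_downWord (by omega) (wordProd_odd _) hlt, ← hd'.2]
    · simp only [List.length_append, length_downWord, List.length_singleton]
      ring
    · have := wordProd_downWord m 0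
      simp only [Nat.cast_zero, zero_add, if_true] at this
      rw [Asc, wordProd_append, Equiv.Perm.mul_apply, this,
        hmW.2 _ (by rw [abs_of_nonneg] <;> omega)]
      omega

/-! ### Stability -/

theorem killX_act_of_lt {i j : ℕ} (h : i + 1 < j) (f : Poly) :
    killX j (act i f) = act i (killX j f) := by
  refine algHom_congr (φ := (killX j).comp (act i)) (ψ := (act i).comp (killX j)) (fun t => ?_)
    (fun t => by simp only [AlgHom.comp_apply, act_y, killX_y]) f
  rw [AlgHom.comp_apply, AlgHom.comp_apply, killX_x]
  by_cases ht : t = j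
  · rw [if_pos ht, act_x_of_ne (by omega) (by omega), killX_x, if_pos ht, map_zero]
  rw [if_neg ht]
  rcases i with _ | i
  · rw [act_zero_x]
    split_ifs
    · rw [map_neg, killX_x, if_neg (by omega)]
    · rw [killX_x, if_neg ht]
  · rw [act_succ_x, killX_x, if_neg]
    rw [Equiv.swap_apply_def]
    split_ifs <;> omega

theorem killX_root_of_lt {i j : ℕ} (h : i + 1 < j) : killX j (root i) = root i := by
  rcases i with _ | i
  · rw [root, map_mul, killX_x, if_neg (by omega), map_ofNat]
  · rw [root, map_sub, killX_x, killX_x, if_neg (by omega), if_neg (by omega)]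

theorem killY_act (i j : ℕ) (f : Poly) : killY j (act i f) = act i (killY j f) := by
  refine algHom_congr (φ := (killY j).comp (act i)) (ψ := (act i).comp (killY j)) (fun t => ?_)
    (fun t => ?_) f
  · rw [AlgHom.comp_apply, AlgHom.comp_apply, killY_x]
    rcases i with _ | i
    · rw [act_zero_x]
      split_ifs
      · rw [map_neg, killY_x]
      · rw [killY_x]
    · rw [act_succ_x, killY_x]
  · rw [AlgHom.comp_apply, AlgHom.comp_apply, act_y, killY_y]
    split_ifs
    · rw [map_zero]
    · rw [act_y]

theorem killY_root (i j : ℕ) : killY j (root i) = root i := by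
  rcases i with _ | i
  · rw [root, map_mul, killY_x, map_ofNat]
  · rw [root, map_sub, killY_x, killY_x]

theorem setZero_x (m n t : ℕ) : setZero m n (x t) = if m < t ∧ t ≤ n then 0 else x t := by
  rw [setZero, x, MvPolynomial.aeval_X, Sum.elim_inl]
  rfl

theorem setZero_y (m n t : ℕ) : setZero m n (y t) = if m < t ∧ t ≤ n then 0 else y t := by
  rw [setZero, y, MvPolynomial.aeval_X, Sum.elim_inr]
  rfl

theorem setZero_succ (m : ℕ) (f : Poly) :
    setZero m (m + 1) f = killX (m + 1) (killY (m + 1) f) := by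
  rw [← AlgHom.comp_apply]
  refine algHom_congr (fun t => ?_) (fun t => ?_) f
  · rw [AlgHom.comp_apply, killY_x, killX_x, setZero_x]
    split_ifs <;> first | rfl | omega
  · rw [AlgHom.comp_apply, killY_y, setZero_y]
    split_ifs
    · rw [map_zero]
    · omega
    · omega
    · rw [killX_y]

theorem setZero_comp {m n : ℕ} (h : m ≤ n) (f : Poly) :
    setZero m (n + 1) f = setZero m n (setZero n (n + 1) f) := by
  rw [← AlgHom.comp_apply]
  refine algHom_congr (fun t => ?_) (fun t => ?_) f
  · rw [AlgHom.comp_apply, setZero_x, setZero_x]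
    by_cases h1 : n < t ∧ t ≤ n + 1
    · rw [if_pos (by omega), if_pos h1, map_zero]
    · rw [if_neg h1, setZero_x]
      exact if_congr (by omega) rfl rfl
  · rw [AlgHom.comp_apply, setZero_y, setZero_y]
    by_cases h1 : n < t ∧ t ≤ n + 1
    · rw [if_pos (by omega), if_pos h1, map_zero]
    · rw [if_neg h1, setZero_y]
      exact if_congr (by omega) rfl rfl

theorem setZero_self (m : ℕ) (f : Poly) : setZero m m f = f := by
  refine algHom_congr (φ := setZero m m) (ψ := AlgHom.id ℤ Poly) (fun t => ?_) (fun t => ?_) f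
  · rw [setZero_x, if_neg (by omega)]
    rfl
  · rw [setZero_y, if_neg (by omega)]
    rfl

/-- y_{m+1} = 0 commutes with all operators and acts on the kernel directly; x_{m+1} = 0 must wait
until the operators have been applied. -/
theorem setZero_ddWord'_qKernel (m : ℕ) :
    setZero m (m + 1) (ddWord' (downWord m ++ [0]) (qKernel (m + 1))) = qKernel m := by
  rw [setZero_succ, map_ddWord' (fun i _ => killY_root i _) fun i _ => killY_act i _,
    killY_qKernel, killX_ddWord'_prodX m fun i h h' => act_qKernelAux h h', killX_qKernelAux]

theorem setZero_schubertC_succ {m : ℕ} (w : W m) (w' : W (m + 1)) (hww : w'.1 = w.1)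
    (hw : IncPos w.1⁻¹) : setZero m (m + 1) (schubertC (m + 1) w') = schubertC m w := by
  have hodd : OddPerm w.1⁻¹ := (inv_mem w.2).1
  have hvW : w.1⁻¹ * (wRho m).1 ∈ W m := mul_mem (inv_mem w.2) (wRho_mem m)
  obtain ⟨d, hd, hdp, hdl⟩ := exists_word_length_eq le_rfl hvW
  have hdR : RedWord m d := ⟨hd, by rw [hdp, hdl]⟩
  -- The word d stays reduced in rank m+1: both counts are attained by words in the generators of
  -- W_m, hence bound each other.
  have hdl' : 2 * d.length = inv (m + 1) (wordProd d) := by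
    obtain ⟨c, hc, hcp, hcl⟩ := exists_word_length_eq (Nat.le_add_right m 1) hvW
    have h1 := inv_wordProd_le hc
    have h2 := inv_wordProd_le (n := m + 1) fun i hi => (hd i hi).trans (Nat.lt_succ_self m)
    rw [hcp] at h1
    rw [hdp] at h2 ⊢
    omega
  have hdR' : RedWord (m + 1) d := ⟨fun i hi => (hd i hi).trans (Nat.lt_succ_self m), hdl'⟩
  have hlt : ∀ i : ℕ, i < m → wordProd d (i + 1 : ℤ) < wordProd d (m + 1 : ℤ) := by
    intro i hi
    rw [(wordProd_mem hd).2 (m + 1 : ℤ) (by rw [abs_of_nonneg] <;> omega)]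
    have h1 := abs_apply_le (wordProd_mem hd) (i := (i + 1 : ℤ))
      (by rw [abs_of_nonneg] <;> omega)
    have := le_abs_self (wordProd d (i + 1 : ℤ))
    omega
  have hp : wordProd (d ++ (downWord m ++ [0])) = w'.1⁻¹ * (wRho (m + 1)).1 := by
    rw [wordProd_append, hdp, mul_assoc, wRho_mul_downWord, hww]
  rw [schubertC_eq (by rwa [hww]) (hdR.append_downWord hdR' hlt) hp, schubertC_eq hw hdR hdp,
    ddWord'_append, setZero_succ, map_ddWord' (fun i _ => killY_root i _) fun i _ => killY_act i _,
    map_ddWord' (fun i hi => killX_root_of_lt (by have := hd i hi; omega))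
      (fun i hi => killX_act_of_lt (by have := hd i hi; omega)),
    ← setZero_succ, setZero_ddWord'_qKernel]

theorem isStable_of_incPos {m : ℕ} {w : W m} (hw : IncPos w.1⁻¹) : IsStable m w := by
  have key : ∀ (n : ℕ) (h : m ≤ n), setZero m n (schubertC n (emb h w)) = schubertC m w := by
    intro n h
    induction n, h using Nat.le_induction with
    | base => exact setZero_self m _
    | succ n h ih =>
      rw [setZero_comp h, setZero_schubertC_succ (emb h w) _ rfl hw, ih]
  exact fun n h => key n h.le

/-- For i ≥ 1, a descent of w⁻¹ at i means that s_i w is shorter than w; then s_i w_{ρ_k} = (s_i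
w)s_{a_1}⋯s_{a_r} is shorter than w_{ρ_k}. But w_{ρ_k} is an involution increasing on positive
integers, so s_i lengthens it on the left as on the right. -/
theorem incPos_of_weakLE {m k : ℕ} {w : W m} (hw : WeakLE (toInf m w) (wRho k)) :
    IncPos w.1⁻¹ := by
  obtain ⟨a, hprod, hlen⟩ := hw
  intro i
  by_contra hdesc
  have hdesc : ¬ Asc w.1⁻¹ (i + 1) := hdesc
  obtain ⟨n, hm, hk, hi, ha⟩ : ∃ n, m ≤ n ∧ k ≤ n ∧ i + 1 < n ∧ ∀ t ∈ a, t < n := by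
    refine ⟨m + k + i + 2 + a.sum, by omega, by omega, by omega, fun t ht => ?_⟩
    have := List.le_sum_of_mem ht
    omega
  have hwn : w.1 ∈ W n := W_mono hm w.2
  have hvn : (wRho k).1 ∈ W n := W_mono hk (wRho_mem k)
  have hsn : sFun (i + 1) ∈ W n := W_mono (Nat.succ_le_of_lt hi) (sFun_mem_W _)
  have hv : (wRho k).1 = w.1 * wordProd a := by
    rw [hprod, Subgroup.coe_mul, Subgroup.val_list_prod, List.map_map]
    rfl
  have h1 := two_mul_length hk (wRho_mem k)
  have h2 : 2 * length (toInf m w) = inv n w.1 := two_mul_length (w := toInf m w) hm w.2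
  have h3 := inv_mul_of_not_asc hi (inv_mem hwn).1 hdesc
  have h4 := inv_mul_of_asc hi hvn.1 (asc_wRho (k := k) (i := i + 1) (by omega))
  -- Inversion preserves length and turns right multiplication into left multiplication.
  have e1 : inv n (w.1⁻¹ * sFun (i + 1)) = inv n (sFun (i + 1) * w.1) := by
    rw [← inv_inv (mul_mem hsn hwn), mul_inv_rev, sFun_inv]
  have e2 : inv n ((wRho k).1 * sFun (i + 1)) = inv n (sFun (i + 1) * (wRho k).1) := by
    rw [← inv_inv (mul_mem hsn hvn), mul_inv_rev, sFun_inv, wRho_inv]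
  have h5 := inv_mul_wordProd_le (n := n) ((sFun_odd (i + 1)).mul hwn.1) ha
  rw [mul_assoc, ← hv] at h5
  rw [inv_inv hwn] at h3
  omega

end TypeC

end

theorem proposition1p6 (k : ℕ) (hk : 0 < k) (m : ℕ) (w : TypeC.W m)
    (hw : TypeC.WeakLE (TypeC.toInf m w) (TypeC.wRho k)) :
    TypeC.IsStable m w :=
  TypeC.isStable_of_incPos (TypeC.incPos_of_weakLE hw)
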